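/- **Lemma (averaging of per-epoch MLEs).** *Setting.* Let $K\ge 1$. For each block (epoch) $k=1,\dots,K$ let $\{f_k(\cdot\mid\lambda)\}$ be a family of probability densities with respect to a $\sigma$-finite measure $\nu_k$, indexed by $\lambda$ in a parameter set $\Lambda_k\subseteq\mathbb R$, and let the true value $\lambda_0$ be interior to every $\Lambda_k$. A block of $m$ independent samples $x_k=(x_{k,1},\dots,x_{k,m})$ has the log-likelihood $\mathcal L_k(x_k\mid\lambda)=\sum_{t=1}^m\log f_k(x_{k,t}\mid\lambda)$. Let $\hat\lambda_k$ be a measurable maximum likelihood estimator based on block $k$: almost surely under $\lambda_0$, $\hat\lambda_k\in\arg\max_{\lambda\in\Lambda_k}\mathcal L_k(x_k\mid\lambda)$. Consider a sequence of stages $n=1,2,\dots$ in which block $k$ has $N_k=N_k^{(n)}$ samples, with $N_k^{(n)}\to\infty$ for every $k$. Suppose that at every stage the log-likelihood of the full data $x=(x_1,\dots,x_K)$ is $\mathcal L(x\mid\lambda)=\sum_{k=1}^K\mathcal L_k(x_k\mid\lambda)$ for $\lambda\in\bigcap_k\Lambda_k$ (so the blocks are independent), and that all blocks have the same Fisher information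 at $\lambda_0$: $J_k(\lambda_0)=E_{\lambda_0}\big[(\partial_\lambda\mathcal L_k)^2\big]=J$ for all $k$, where $J=J^{(n)}$. Put $\bar\lambda=\frac1K\sum_{k=1}^K\hat\lambda_k$. An estimator $T$ has *asymptotic variance* $v=v^{(n)}$ if $(T-\lambda_0)/\sqrt{v}\to\mathcal N(0,1)$ in distribution under $\lambda_0$ as $n\to\infty$. It is *asymptotically efficient* if this holds with $v$ equal to the Cramér–Rao bound of the full data, the reciprocal of the Fisher information $E_{\lambda_0}\big[(\partial_\lambda\mathcal L)^2\big]$ of the full data. *Conclusion.* In each of the cases (a) and (b) below, the Cramér–Rao bound of the full data equals $1/(KJ)$ at every stage (with $1/0$ read as $0$), $\bar\lambda$ has the asymptotic variance $1/(KJ)$, and $\bar\lambda$ is therefore an asymptotically efficient estimator of $\lambda$ at $\lambda_0$. (a) *General block likelihoods.* Each $\hat\lambda_k$ is consistent at $\lambda_0$ (it converges in probability to $\lambda_0$ as $m\to\infty$), and each family $f_k$ satisfies the classical regularity conditions at $\lambda_0$: for $\lambda\in\Lambda_k$ the density $f_k(\cdot\mid\lambda)$ is measurable and everywhere positive; on an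 open neighbourhood $U\subseteq\Lambda_k$ of $\lambda_0$ it is twice continuously differentiable in $\lambda$; there are a $\nu_k$-integrable function $g$ and a function $M$ with $E_{\lambda_0}|M|<\infty$ such that, for $\nu_k$-almost every $x$ and all $\lambda\in U$, $|\partial_\lambda f_k|\le g(x)$, $|\partial^2_\lambda f_k|\le g(x)$ and $|\partial_\lambda^2\log f_k|\le M(x)$; and the Fisher information of one sample at $\lambda_0$ is positive. (b) *Single source in colored noise.* The samples of block $k$ are vectors in $\mathbb C^p$ with the zero-mean circular complex Gaussian density $$f_k(x\mid\lambda)=\frac{1}{\pi^p\det R_k(\lambda)}\,e^{-x^{H}R_k(\lambda)^{-1}x},\qquad R_k(\lambda)=\lambda a_ka_k^{H}+C_k,$$ where $\lambda$ is the source power, the array response $a_k\in\mathbb C^p$ is nonzero, the noise covariance $C_k$ is Hermitian positive definite (both known), and $R_k(\lambda)$ is positive definite for all $\lambda\in\Lambda_k$ (for instance $\Lambda_k=[0,\infty)$). Here neither consistency nor regularity is assumed. -/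

import Mathlib

universe u

open MeasureTheory ProbabilityTheory Filter Topology
open scoped ComplexOrder

noncomputable section

namespace BlockMLE

section Likelihood

variable {X : Type*} [MeasurableSpace X]

/-- The law with density `p l` (at the parameter value `l`) with respect to `μ`. -/
def law (μ : Measure X) (p : ℝ → X → ℝ) (l : ℝ) : Measure X :=
  μ.withDensity fun x => ENNReal.ofReal (p l x)

/-- The log-likelihood of the parameter value `l` given the data `x`. -/
def logLik {X : Type*} (p : ℝ → X → ℝ) (l : ℝ) (x : X) : ℝ := Real.log (p l x)

/-- The score: the derivative of the log-likelihood with respect to the parameter. -/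
def score {X : Type*} (p : ℝ → X → ℝ) (l : ℝ) (x : X) : ℝ := deriv (fun l' => logLik p l' x) l

/-- The Fisher information about the parameter at `l`: the expectation, under the law at `l`, of
the squared score. -/
def fisherInfo (μ : Measure X) (p : ℝ → X → ℝ) (l : ℝ) : ℝ :=
  ∫ x, score p l x ^ 2 ∂(law μ p l)

/-- The Cramér–Rao bound at `l`: the reciprocal of the Fisher information. -/
def crBound (μ : Measure X) (p : ℝ → X → ℝ) (l : ℝ) : ℝ := 1 / fisherInfo μ p l

/-- `lhat` is a maximum likelihood estimate over the parameter set `Λ` given the data `x`. -/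
def IsMLE {X : Type*} (p : ℝ → X → ℝ) (Λ : Set ℝ) (x : X) (lhat : ℝ) : Prop :=
  lhat ∈ Λ ∧ ∀ l ∈ Λ, logLik p l x ≤ logLik p lhat x

end Likelihood

section Samples

variable {E : Type*} [MeasurableSpace E]

/-- Reference measure for a block of `m` samples. -/
def blockBase (ν : Measure E) (m : ℕ) : Measure (Fin m → E) := Measure.pi fun _ => ν

/-- Density of a block of `m` independent samples, each with density `f l`. -/
def blockDensity {E : Type*} (f : ℝ → E → ℝ) (m : ℕ) (l : ℝ) (x : Fin m → E) : ℝ :=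
  ∏ t, f l (x t)

/-- Classical regularity of a one-parameter density family at the interior point `l₀` of the
parameter set `Λ`: common support, two derivatives in the parameter, dominated derivatives of
the density, dominated second derivative of the log-density, nonzero Fisher information. -/
structure IsRegularAt (ν : Measure E) (f : ℝ → E → ℝ) (Λ : Set ℝ) (l₀ : ℝ) : Prop where
  measurable : ∀ l ∈ Λ, Measurable (f l)
  pos : ∀ l ∈ Λ, ∀ x, 0 < f l x
  prob : ∀ l ∈ Λ, IsProbabilityMeasure (law ν f l)
  smooth : ∃ U : Set ℝ, IsOpen U ∧ l₀ ∈ U ∧ U ⊆ Λ ∧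
    (∀ x, ContDiffOn ℝ 2 (fun l => f l x) U) ∧
    ∃ g M : E → ℝ, Integrable g ν ∧ Integrable M (law ν f l₀) ∧
      ∀ᵐ x ∂ν, ∀ l ∈ U,
        |deriv (fun l' => f l' x) l| ≤ g x ∧
        |iteratedDeriv 2 (fun l' => f l' x) l| ≤ g x ∧
        |iteratedDeriv 2 (fun l' => logLik f l' x) l| ≤ M x
  info_pos : 0 < fisherInfo ν f l₀

end Samples

section Blocks

variable {K : ℕ} {E : Fin K → Type*} [∀ k, MeasurableSpace (E k)]

/-- Full data: block `k` consists of `N k` samples in `E k`. -/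
abbrev FullData {K : ℕ} (E : Fin K → Type*) (N : Fin K → ℕ) : Type _ :=
  ∀ k : Fin K, Fin (N k) → E k

/-- Reference measure for the full data. -/
def fullBase (ν : ∀ k, Measure (E k)) (N : Fin K → ℕ) : Measure (FullData E N) :=
  Measure.pi fun k => blockBase (ν k) (N k)

/-- Density of the full data when the blocks are independent. -/
def fullDensity {K : ℕ} {E : Fin K → Type*} (f : ∀ k, ℝ → E k → ℝ) (N : Fin K → ℕ) (l : ℝ)
    (x : FullData E N) : ℝ :=
  ∏ k, blockDensity (f k) (N k) l (x k)

/-- The average over the blocks of the per-block estimates. -/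
def averageEst {K : ℕ} {E : Fin K → Type*} (est : ∀ k : Fin K, ∀ m : ℕ, (Fin m → E k) → ℝ)
    (N : Fin K → ℕ) (x : FullData E N) : ℝ :=
  (1 / (K : ℝ)) * ∑ k, est k (N k) (x k)

end Blocks

section Asymptotics

variable {X : ℕ → Type*} [∀ n, MeasurableSpace (X n)]

/-- Consistency: `T n` converges in probability to `l₀`, where the data have the law `P n`. -/
def IsConsistent (P : ∀ n, Measure (X n)) (T : ∀ n, X n → ℝ) (l₀ : ℝ) : Prop :=
  ∀ ε : ℝ, 0 < ε → Tendsto (fun n => P n {x | ε ≤ |T n x - l₀|}) atTop (𝓝 0)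

/-- `T n` is asymptotically normal around `l₀` with asymptotic variance `v n`:
`(T n - l₀) / √(v n)` converges in distribution to the standard normal law. -/
def HasAsymptoticVariance (P : ∀ n, Measure (X n)) (T : ∀ n, X n → ℝ) (l₀ : ℝ) (v : ℕ → ℝ) :
    Prop :=
  ∃ _ : ∀ n, IsProbabilityMeasure (P n),
    TendstoInDistribution (fun n x => (T n x - l₀) / √(v n)) atTop (id : ℝ → ℝ) P
      (gaussianReal 0 1)

/-- Asymptotic efficiency at `l₀`: the asymptotic variance is the Cramér–Rao bound. -/
def IsAsymptoticallyEfficient (μ : ∀ n, Measure (X n)) (p : ∀ n, ℝ → X n → ℝ)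
    (T : ∀ n, X n → ℝ) (l₀ : ℝ) : Prop :=
  HasAsymptoticVariance (fun n => law (μ n) (p n) l₀) T l₀ fun n => crBound (μ n) (p n) l₀

end Asymptotics

section ColoredNoise

variable {p : ℕ}

/-- Covariance `l a aᴴ + C` of a single source of power `l` with array response `a` in noise of
covariance `C`. -/
def sourceCov (a : Fin p → ℂ) (C : Matrix (Fin p) (Fin p) ℂ) (l : ℝ) :
    Matrix (Fin p) (Fin p) ℂ :=
  (l : ℂ) • Matrix.vecMulVec a (star a) + C

/-- Density `exp (- xᴴ R⁻¹ x) / (π ^ p det R)` of the zero-mean circular complex Gaussian law with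
covariance `R` with respect to Lebesgue measure on `ℂ ^ p`. -/
def complexGaussianDensity (R : Matrix (Fin p) (Fin p) ℂ) (x : Fin p → ℂ) : ℝ :=
  1 / (Real.pi ^ p * R.det.re) * Real.exp (-(star x ⬝ᵥ (R⁻¹.mulVec x)).re)

/-- Density of one array sample as a function of the source power `l`. -/
def sourceDensity (a : Fin p → ℂ) (C : Matrix (Fin p) (Fin p) ℂ) (l : ℝ) (x : Fin p → ℂ) : ℝ :=
  complexGaussianDensity (sourceCov a C l) x

end ColoredNoise

end BlockMLE

end

/-!
The statement is reduced to one property of each block, asymptotic linearity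
(`IsAsymptoticallyLinear`): with `I` the Fisher information of one sample of the block,
`√(m I) (λ̂ - λ₀)` and the standardized score sum `(m I)^(-1/2) ∑ score` differ by a term that tends
to `0` in probability. The central limit theorem and Slutsky's theorem then show that
`√(m I) (λ̂ - λ₀)` is asymptotically standard normal. At stage `n` every block has `m I = J`, and
`√(K J) (λ̄ - λ₀)` is `1 / √K` times the sum of the `K` independent terms `√J (λ̂ₖ - λ₀)`, so its
characteristic function is a product of `K` factors that each tend to `exp (-t ^ 2 / (2 K))`; Lévy's
continuity theorem concludes (`averageEst_efficient`). Scores are centred, so the Fisher information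
of independent components adds up (`IsScoreRegular.pi`), and the Cramér–Rao bound of the full data
is `1 / (K J)`.

For general likelihoods (`IsRegularAt.isAsymptoticallyLinear`) a consistent maximum likelihood
estimate is with high probability an interior local maximum. The likelihood equation is expanded
around `λ₀`; the average second derivative of the log-likelihood is close to `-I` uniformly near
`λ₀`, by the law of large numbers applied at `λ₀` and to an integrable envelope of its oscillation
(`exists_oscillation_envelope`). The information identities (`IsRegularAt.exists_nhds`) come from
differentiating the total mass of the density twice under the integral sign.

For a single source in Gaussian noise, the matrix determinant lemma and the Sherman–Morrison formula
turn the density into a factor free of `λ` times `(1 + λ s)⁻¹ exp (λ y / (1 + λ s))`, where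
`s = aᴴ C⁻¹ a` and `y = |aᴴ C⁻¹ x| ^ 2` (`sourceDensity_eq`). Since these densities have total mass
`1`, the moment generating function of `y` is explicit (`IsExpFamily.mgf_eventually`), hence so are
its first two moments. The likelihood of a block has a unique maximizer, an affine function of the
mean of `y`, which lies in the parameter set with probability tending to `1` by the law of large
numbers, and for which the remainder in the linearity property vanishes
(`IsExpFamily.isAsymptoticallyLinear`).
-/

namespace BlockMLE

/-! ### Families with a centred square-integrable score, and their products -/

/-- What the argument needs of a density family at the single parameter value `l₀`: near `l₀` it is
positive, at `l₀` it is a probability density that is differentiable in the parameter, and its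
score there is centred and square integrable. -/
structure IsScoreRegular {X : Type*} [MeasurableSpace X] (μ : Measure X) (f : ℝ → X → ℝ)
    (l₀ : ℝ) : Prop where
  measurable : Measurable (f l₀)
  pos : ∀ᶠ l in 𝓝 l₀, ∀ x, 0 < f l x
  prob : IsProbabilityMeasure (law μ f l₀)
  diff : ∀ x, DifferentiableAt ℝ (fun l => f l x) l₀
  measurable_score : Measurable (score f l₀)
  memLp_score : MemLp (score f l₀) 2 (law μ f l₀)
  integral_score : ∫ x, score f l₀ x ∂(law μ f l₀) = 0

lemma integrable_of_isProbabilityMeasure_law {X : Type*} [MeasurableSpace X] {μ : Measure X}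
    {f : ℝ → X → ℝ} {l : ℝ} (hm : AEStronglyMeasurable (f l) μ) (hpos : ∀ x, 0 ≤ f l x)
    (hp : IsProbabilityMeasure (law μ f l)) : Integrable (f l) μ := by
  refine ⟨hm, ?_⟩
  rw [hasFiniteIntegral_iff_ofReal (ae_of_all _ hpos)]
  have h := hp.measure_univ
  rw [law, withDensity_apply _ MeasurableSet.univ, Measure.restrict_univ] at h
  simp [h]

lemma integral_law {X : Type*} [MeasurableSpace X] {μ : Measure X} {f : ℝ → X → ℝ} {l : ℝ}
    (hm : Measurable (f l)) (hpos : ∀ x, 0 ≤ f l x) (g : X → ℝ) :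
    ∫ x, g x ∂(law μ f l) = ∫ x, f l x * g x ∂μ := by
  rw [law, integral_withDensity_eq_integral_toReal_smul (by fun_prop) (by simp)]
  simp [ENNReal.toReal_ofReal, hpos]

lemma integral_eq_one_of_law {X : Type*} [MeasurableSpace X] {μ : Measure X} {f : ℝ → X → ℝ}
    {l : ℝ} (hm : Measurable (f l)) (hpos : ∀ x, 0 ≤ f l x)
    (hp : IsProbabilityMeasure (law μ f l)) : ∫ x, f l x ∂μ = 1 := by
  have h := integral_law (μ := μ) hm hpos (fun _ => 1)
  simpa using h.symm

section Pi

variable {ι : Type*} [Fintype ι] {X : ι → Type*} [∀ i, MeasurableSpace (X i)]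

/-- Densities multiply over independent components. -/
lemma pi_law (μ : ∀ i, Measure (X i)) [∀ i, SigmaFinite (μ i)] (f : ∀ i, ℝ → X i → ℝ) (l : ℝ)
    (hm : ∀ i, Measurable (f i l)) (hpos : ∀ i x, 0 ≤ f i l x)
    (hp : ∀ i, IsProbabilityMeasure (law (μ i) (f i) l)) :
    law (Measure.pi μ) (fun l x => ∏ i, f i l (x i)) l =
      Measure.pi fun i => law (μ i) (f i) l := by
  have hint i := integrable_of_isProbabilityMeasure_law (hm i).aestronglyMeasurable (hpos i) (hp i)
  refine (Measure.pi_eq fun s hs => ?_).symm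
  rw [law, withDensity_apply _ (MeasurableSet.univ_pi hs), ← lintegral_indicator
    (MeasurableSet.univ_pi hs)]
  have h1 : ∀ x : ∀ i, X i, (Set.univ.pi s).indicator
      (fun x => ENNReal.ofReal (∏ i, f i l (x i))) x =
      ENNReal.ofReal (∏ i, (s i).indicator (f i l) (x i)) := by
    intro x
    by_cases hx : x ∈ Set.univ.pi s
    · rw [Set.indicator_of_mem hx]
      congr 1
      exact Finset.prod_congr rfl fun i _ => (Set.indicator_of_mem (hx i trivial) _).symm
    · rw [Set.indicator_of_notMem hx]
      simp only [Set.mem_pi, Set.mem_univ, true_implies, not_forall] at hx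
      obtain ⟨i, hi⟩ := hx
      rw [Finset.prod_eq_zero (Finset.mem_univ i) (Set.indicator_of_notMem hi _)]
      simp
  simp_rw [h1]
  have hnn i x : 0 ≤ (s i).indicator (f i l) x := Set.indicator_nonneg (fun x _ => hpos i x) x
  rw [← ofReal_integral_eq_lintegral_ofReal
    (Integrable.fintype_prod_dep fun i => (hint i).indicator (hs i))
    (ae_of_all _ fun x => Finset.prod_nonneg fun i _ => hnn i _), integral_fintype_prod_eq_prod,
    ENNReal.ofReal_prod_of_nonneg fun i _ => integral_nonneg (hnn i)]
  refine Finset.prod_congr rfl fun i _ => ?_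
  rw [law, withDensity_apply _ (hs i), integral_indicator (hs i),
    ofReal_integral_eq_lintegral_ofReal (hint i).integrableOn (ae_of_all _ (hpos i))]

lemma IsScoreRegular.score_pi {μ : ∀ i, Measure (X i)} {f : ∀ i, ℝ → X i → ℝ} {l₀ : ℝ}
    (h : ∀ i, IsScoreRegular (μ i) (f i) l₀) (x : ∀ i, X i) :
    score (fun l x => ∏ i, f i l (x i)) l₀ x = ∑ i, score (f i) l₀ (x i) := by
  have hne i : f i l₀ (x i) ≠ 0 := ((h i).pos.self_of_nhds (x i)).ne'
  have hev : (fun l => logLik (fun l x => ∏ i, f i l (x i)) l x) =ᶠ[𝓝 l₀]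
      fun l => ∑ i, logLik (f i) l (x i) := by
    filter_upwards [eventually_all.2 fun i => (h i).pos] with l hl
    exact Real.log_prod fun i _ => (hl i (x i)).ne'
  rw [score, hev.deriv_eq, deriv_fun_sum]
  · rfl
  · exact fun i _ => ((h i).diff (x i)).log (hne i)

/-- The score of a product of independent families is the sum of the scores; as these are centred,
Fisher informations add up. -/
lemma IsScoreRegular.pi {μ : ∀ i, Measure (X i)} [∀ i, SigmaFinite (μ i)]
    {f : ∀ i, ℝ → X i → ℝ} {l₀ : ℝ} (h : ∀ i, IsScoreRegular (μ i) (f i) l₀) :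
    IsScoreRegular (Measure.pi μ) (fun l x => ∏ i, f i l (x i)) l₀ ∧
      fisherInfo (Measure.pi μ) (fun l x => ∏ i, f i l (x i)) l₀ =
        ∑ i, fisherInfo (μ i) (f i) l₀ := by
  have hnn i x : 0 ≤ f i l₀ x := ((h i).pos.self_of_nhds x).le
  have hp i := (h i).prob
  have hlaw := pi_law μ f l₀ (fun i => (h i).measurable) hnn hp
  have hsc : score (fun l x => ∏ i, f i l (x i)) l₀ =
      ∑ i, fun x : ∀ i, X i => score (f i) l₀ (x i) := by
    ext x
    rw [score_pi h, Finset.sum_apply]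
  have hL i : MemLp (fun x : ∀ i, X i => score (f i) l₀ (x i)) 2
      (Measure.pi fun i => law (μ i) (f i) l₀) :=
    (h i).memLp_score.comp_measurePreserving (measurePreserving_eval _ i)
  have hmean : ∫ x, score (fun l x => ∏ i, f i l (x i)) l₀ x
      ∂(law (Measure.pi μ) (fun l x => ∏ i, f i l (x i)) l₀) = 0 := by
    rw [hlaw]
    simp_rw [score_pi h]
    rw [integral_finsetSum _ fun i _ => (hL i).integrable (by norm_num)]
    refine Finset.sum_eq_zero fun i _ => ?_
    rw [← (h i).integral_score]
    exact integral_comp_eval (μ := fun i => law (μ i) (f i) l₀) (h i).memLp_score.1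
  have hmeas : Measurable (score (fun l (x : ∀ i, X i) => ∏ i, f i l (x i)) l₀) := by
    rw [funext (score_pi h)]
    exact Finset.measurable_sum _ fun i _ => (h i).measurable_score.comp (measurable_pi_apply i)
  refine ⟨⟨?_, ?_, ?_, ?_, hmeas, ?_, hmean⟩, ?_⟩
  · exact Finset.measurable_fun_prod _ fun i _ => (h i).measurable.comp (measurable_pi_apply i)
  · filter_upwards [eventually_all.2 fun i => (h i).pos] with l hl x
    exact Finset.prod_pos fun i _ => hl i (x i)
  · rw [hlaw]; infer_instance
  · exact fun x => DifferentiableAt.fun_finsetProd fun i _ => (h i).diff (x i)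
  · rw [hlaw, hsc]
    exact memLp_finsetSum' _ fun i _ => hL i
  · have h1 := variance_sum_pi fun i => (h i).memLp_score
    rw [← hsc, ← hlaw, variance_of_integral_eq_zero hmeas.aemeasurable hmean] at h1
    rw [fisherInfo, h1]
    refine Finset.sum_congr rfl fun i _ => ?_
    rw [variance_of_integral_eq_zero (h i).measurable_score.aemeasurable (h i).integral_score]
    rfl

end Pi

/-! ### Asymptotically linear block estimators and their average -/

section OneBlock

variable {E : Type*} [MeasurableSpace E]

lemma measurePreserving_initial (P : Measure E) [IsProbabilityMeasure P] (m : ℕ) :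
    MeasurePreserving (fun (ω : ℕ → E) (i : Fin m) => ω i) (Measure.infinitePi fun _ => P)
      (Measure.pi fun _ => P) := by
  refine ⟨by fun_prop, ?_⟩
  rw [← Measure.infinitePi_eq_pi]
  exact Measure.map_infinitePi_infinitePi_of_inj (P := fun _ : ℕ => P) Fin.val_injective

lemma iIndepFun_coord (P : Measure E) [IsProbabilityMeasure P] {g : E → ℝ} (hg : Measurable g) :
    iIndepFun (fun (i : ℕ) (ω : ℕ → E) => g (ω i)) (Measure.infinitePi fun _ => P) :=
  iIndepFun_infinitePi (P := fun _ : ℕ => P) (X := fun _ => g) fun _ => hg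

lemma identDistrib_coord (P : Measure E) [IsProbabilityMeasure P] {g : E → ℝ} (hg : Measurable g)
    (i : ℕ) : IdentDistrib (fun ω : ℕ → E => g (ω i)) (fun ω => g (ω 0))
      (Measure.infinitePi fun _ => P) (Measure.infinitePi fun _ => P) := by
  have h (j : ℕ) := (measurePreserving_eval_infinitePi (fun _ : ℕ => P) j).map_eq
  refine ⟨(hg.comp (measurable_pi_apply i)).aemeasurable,
    (hg.comp (measurable_pi_apply 0)).aemeasurable, ?_⟩
  refine (Measure.map_map hg (measurable_pi_apply i)).symm.trans ?_
  exact (congrArg _ ((h i).trans (h 0).symm)).trans (Measure.map_map hg (measurable_pi_apply 0))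

lemma integral_coord (P : Measure E) [IsProbabilityMeasure P] {g : E → ℝ} (hg : Measurable g)
    (i : ℕ) : ∫ ω : ℕ → E, g (ω i) ∂(Measure.infinitePi fun _ => P) = ∫ x, g x ∂P := by
  have h := (measurePreserving_eval_infinitePi (fun _ : ℕ => P) i).map_eq
  rw [← integral_map (φ := fun ω : ℕ → E => ω i) (measurable_pi_apply i).aemeasurable
    hg.aestronglyMeasurable]
  exact congrArg (fun Q => ∫ x, g x ∂Q) h

/-- The weak law of large numbers along a sequence of independent samples. -/
lemma tendstoInMeasure_average (P : Measure E) [IsProbabilityMeasure P] {g : E → ℝ}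
    (hg : Measurable g) (hi : Integrable g P) :
    TendstoInMeasure (Measure.infinitePi fun _ : ℕ => P)
      (fun (m : ℕ) ω => (∑ i ∈ Finset.range m, g (ω i)) / m) atTop fun _ => ∫ x, g x ∂P := by
  refine tendstoInMeasure_of_tendsto_ae (fun m => ?_) ?_
  · exact ((Finset.measurable_sum _ fun i _ => hg.comp (measurable_pi_apply i)).div_const
      _).aestronglyMeasurable
  · rw [← integral_coord P hg 0]
    refine strong_law_ae_real (fun (i : ℕ) (ω : ℕ → E) => g (ω i)) ?_
      (fun i j hij => (iIndepFun_coord P hg).indepFun hij) (identDistrib_coord P hg)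
    exact (measurePreserving_eval_infinitePi (fun _ : ℕ => P) 0).integrable_comp_of_integrable hi

/-- The estimators `est m` based on `m` samples are asymptotically linear at `l₀` with the score as
influence function: `√(m I) (est m - l₀)` and the standardized score sum differ by a term that
tends to `0` in probability. The samples are the coordinates of an infinite sequence, so that all
sample sizes live on one probability space. -/
def IsAsymptoticallyLinear (ν : Measure E) (f : ℝ → E → ℝ) (l₀ : ℝ)
    (est : ∀ m : ℕ, (Fin m → E) → ℝ) [IsProbabilityMeasure (law ν f l₀)] : Prop :=
  TendstoInMeasure (Measure.infinitePi fun _ : ℕ => law ν f l₀)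
    (fun (m : ℕ) ω => √(m * fisherInfo ν f l₀) * (est m (fun i => ω i) - l₀) -
      (√(m * fisherInfo ν f l₀))⁻¹ * ∑ i ∈ Finset.range m, score f l₀ (ω i)) atTop 0

lemma IsScoreRegular.blockDensity {ν : Measure E} [SigmaFinite ν] {f : ℝ → E → ℝ} {l₀ : ℝ}
    (hf : IsScoreRegular ν f l₀) (m : ℕ) :
    IsScoreRegular (blockBase ν m) (blockDensity f m) l₀ ∧
      fisherInfo (blockBase ν m) (BlockMLE.blockDensity f m) l₀ = m * fisherInfo ν f l₀ := by
  have h := IsScoreRegular.pi (μ := fun _ : Fin m => ν) (f := fun _ => f) fun _ => hf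
  rw [Finset.sum_const, Finset.card_univ, Fintype.card_fin, nsmul_eq_mul] at h
  exact h

lemma IsScoreRegular.law_block {ν : Measure E} [SigmaFinite ν] {f : ℝ → E → ℝ} {l₀ : ℝ}
    (hf : IsScoreRegular ν f l₀) (m : ℕ) :
    law (blockBase ν m) (BlockMLE.blockDensity f m) l₀ = Measure.pi fun _ => law ν f l₀ :=
  pi_law (fun _ : Fin m => ν) (fun _ => f) l₀ (fun _ => hf.measurable)
    (fun _ x => (hf.pos.self_of_nhds x).le) fun _ => hf.prob

/-- A block estimator that is asymptotically linear in the score is asymptotically standard normal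
after multiplication by the square root of the Fisher information of the block. -/
lemma IsAsymptoticallyLinear.tendsto_charFun {ν : Measure E} [SigmaFinite ν] {f : ℝ → E → ℝ}
    {l₀ : ℝ} (hf : IsScoreRegular ν f l₀) (hI : 0 < fisherInfo ν f l₀)
    {est : ∀ m : ℕ, (Fin m → E) → ℝ} (hest : ∀ m, Measurable (est m))
    [IsProbabilityMeasure (law ν f l₀)] (hlin : IsAsymptoticallyLinear ν f l₀ est) (t : ℝ) :
    Tendsto (fun m : ℕ => charFun ((law (blockBase ν m) (blockDensity f m) l₀).map
      fun x => √(m * fisherInfo ν f l₀) * (est m x - l₀)) t) atTop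
      (𝓝 (charFun (gaussianReal 0 1) t)) := by
  set P := law ν f l₀
  set I := fisherInfo ν f l₀
  have hs := hf.measurable_score
  have hg : Measurable fun x => score f l₀ x / √I := hs.div_const _
  have hclt := tendstoInDistribution_inv_sqrt_mul_sum (P := Measure.infinitePi fun _ : ℕ => P)
    (P' := gaussianReal 0 1) (Y := id) (X := fun (i : ℕ) ω => score f l₀ (ω i) / √I)
    ⟨aemeasurable_id, Measure.map_id⟩ ?_ ?_ (iIndepFun_coord P hg) (identDistrib_coord P hg)
  · have hdist := tendstoInDistribution_of_tendstoInMeasure_sub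
      (fun (m : ℕ) (ω : ℕ → E) => √(m * I) * (est m (fun i => ω i) - l₀)) id hclt ?_ ?_
    · have h := ProbabilityMeasure.tendsto_iff_tendsto_charFun.1 hdist.tendsto t
      simp only [ProbabilityMeasure.coe_mk, Measure.map_id] at h
      refine h.congr fun m => ?_
      rw [hf.law_block m, ← (measurePreserving_initial P m).map_eq, Measure.map_map
        (((hest m).sub_const _).const_mul _) (measurePreserving_initial P m).measurable]
      rfl
    · refine TendstoInMeasure.congr_left (fun m => ?_) hlin
      refine ae_of_all _ fun ω => ?_
      simp only [Pi.sub_apply]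
      rw [← Finset.sum_div, Real.sqrt_mul (Nat.cast_nonneg m), mul_inv]
      ring
    · intro m
      exact ((((hest m).comp (measurePreserving_initial P m).measurable).sub_const
        _).const_mul _).aemeasurable
  · rw [integral_coord P hg 0, integral_div, hf.integral_score, zero_div]
  · have h2 : Measurable fun x => (score f l₀ x / √I) ^ 2 := hg.pow_const 2
    have h3 := integral_coord P h2 0
    simp only [Pi.pow_apply] at h3 ⊢
    rw [h3]
    simp_rw [div_pow, Real.sq_sqrt hI.le]
    rw [integral_div]
    exact div_self hI.ne'

end OneBlock

section Average

variable {K : ℕ} {E : Fin K → Type*} [∀ k, MeasurableSpace (E k)]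

/-- Independent blocks, each with the same Fisher information `J`: the characteristic function of
the standardized average is a product of characteristic functions of the standardized block
estimators at `t / √K`, so the average of asymptotically linear block estimators is asymptotically
normal with variance `1 / (K J)`. -/
theorem averageEst_efficient (hK : 0 < K) {N : ℕ → Fin K → ℕ}
    (hN : ∀ k, Tendsto (fun n => N n k) atTop atTop) {l₀ : ℝ} {J : ℕ → ℝ}
    {ν : ∀ k, Measure (E k)} [∀ k, SigmaFinite (ν k)] {f : ∀ k, ℝ → E k → ℝ}
    (hf : ∀ k, IsScoreRegular (ν k) (f k) l₀) (hI : ∀ k, 0 < fisherInfo (ν k) (f k) l₀)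
    [∀ k, IsProbabilityMeasure (law (ν k) (f k) l₀)]
    {p : ∀ n, ℝ → FullData E (N n) → ℝ}
    (hp : ∀ n, ∀ᶠ l in 𝓝 l₀, p n l = fullDensity f (N n) l)
    {est : ∀ k : Fin K, ∀ m : ℕ, (Fin m → E k) → ℝ} (hest : ∀ k m, Measurable (est k m))
    (hlin : ∀ k, IsAsymptoticallyLinear (ν k) (f k) l₀ (est k))
    (hJ : ∀ n k, fisherInfo (blockBase (ν k) (N n k)) (blockDensity (f k) (N n k)) l₀ = J n) :
    (∀ n, crBound (fullBase ν (N n)) (p n) l₀ = 1 / (K * J n)) ∧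
      HasAsymptoticVariance (fun n => law (fullBase ν (N n)) (p n) l₀)
        (fun n => averageEst est (N n)) l₀ (fun n => 1 / (K * J n)) ∧
      IsAsymptoticallyEfficient (fun n => fullBase ν (N n)) p
        (fun n => averageEst est (N n)) l₀ := by
  have hblock n k := (hf k).blockDensity (N n k)
  have : ∀ n k, SigmaFinite (blockBase (ν k) (N n k)) := fun n k => by
    unfold blockBase; infer_instance
  have hfull n := IsScoreRegular.pi fun k => (hblock n k).1
  have hlaw n : law (fullBase ν (N n)) (p n) l₀ =
      Measure.pi fun k => law (blockBase (ν k) (N n k)) (blockDensity (f k) (N n k)) l₀ := by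
    have h : law (fullBase ν (N n)) (p n) l₀ = law (fullBase ν (N n)) (fullDensity f (N n)) l₀ := by
      rw [law, (hp n).self_of_nhds]; rfl
    rw [h]
    exact pi_law _ (fun k => blockDensity (f k) (N n k)) l₀ (fun k => (hblock n k).1.measurable)
      (fun k x => ((hblock n k).1.pos.self_of_nhds x).le) fun k => (hblock n k).1.prob
  have hCR n : crBound (fullBase ν (N n)) (p n) l₀ = 1 / (K * J n) := by
    have hscore : score (p n) l₀ = score (fullDensity f (N n)) l₀ := by
      ext x
      refine Filter.EventuallyEq.deriv_eq ?_
      filter_upwards [hp n] with l hl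
      rw [logLik, logLik, hl]
    have h := (hfull n).2
    simp_rw [hJ n] at h
    rw [Finset.sum_const, Finset.card_univ, Fintype.card_fin, nsmul_eq_mul] at h
    rw [crBound, ← h, fisherInfo, fisherInfo, hscore, law, (hp n).self_of_nhds]
    rfl
  have hprob n k : IsProbabilityMeasure
      (law (blockBase (ν k) (N n k)) (blockDensity (f k) (N n k)) l₀) := (hblock n k).1.prob
  have hK' : (0 : ℝ) < K := by exact_mod_cast hK
  have hvar : HasAsymptoticVariance (fun n => law (fullBase ν (N n)) (p n) l₀)
      (fun n => averageEst est (N n)) l₀ (fun n => 1 / (K * J n)) := by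
    have hPn n : IsProbabilityMeasure (law (fullBase ν (N n)) (p n) l₀) := by
      rw [hlaw]; infer_instance
    have hmeas n : Measurable fun x => (averageEst est (N n) x - l₀) / √(1 / (K * J n)) := by
      refine Measurable.div_const (Measurable.sub_const ?_ _) _
      exact (Finset.measurable_sum _ fun k _ =>
        (hest k (N n k)).comp (measurable_pi_apply k)).const_mul _
    refine ⟨hPn, fun n => (hmeas n).aemeasurable, aemeasurable_id, ?_⟩
    refine ProbabilityMeasure.tendsto_iff_tendsto_charFun.2 fun t => ?_
    simp only [ProbabilityMeasure.coe_mk, Measure.map_id]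
    -- the standardized average as a sum of functions of the independent blocks
    have hsum n (x : FullData E (N n)) : (averageEst est (N n) x - l₀) / √(1 / (K * J n)) =
        ∑ k, (√K)⁻¹ * (√(N n k * fisherInfo (ν k) (f k) l₀) * (est k (N n k) (x k) - l₀)) := by
      have h1 k : N n k * fisherInfo (ν k) (f k) l₀ = J n := by rw [← (hblock n k).2, hJ]
      simp_rw [h1, ← Finset.mul_sum]
      rw [Finset.sum_sub_distrib, Finset.sum_const, Finset.card_univ, Fintype.card_fin,
        nsmul_eq_mul, averageEst, one_div, one_div, Real.sqrt_inv, Real.sqrt_mul hK'.le,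
        div_inv_eq_mul]
      have h2 : √(K : ℝ) * √(K : ℝ) = K := Real.mul_self_sqrt hK'.le
      have h3 : √(K : ℝ) ≠ 0 := (Real.sqrt_pos.2 hK').ne'
      field_simp
      rw [pow_two, h2]
      ring
    have hchar n : charFun ((law (fullBase ν (N n)) (p n) l₀).map
        fun x => (averageEst est (N n) x - l₀) / √(1 / (K * J n))) t =
        ∏ k, charFun ((law (blockBase (ν k) (N n k)) (blockDensity (f k) (N n k)) l₀).map
          fun x => √(N n k * fisherInfo (ν k) (f k) l₀) * (est k (N n k) x - l₀))
          ((√K)⁻¹ * t) := by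
      have hm k : Measurable fun x =>
          √(N n k * fisherInfo (ν k) (f k) l₀) * (est k (N n k) x - l₀) :=
        ((hest k _).sub_const _).const_mul _
      have hm' k : Measurable fun x => (√(K : ℝ))⁻¹ *
          (√(N n k * fisherInfo (ν k) (f k) l₀) * (est k (N n k) x - l₀)) :=
        (hm k).const_mul _
      simp_rw [hsum, hlaw]
      rw [iIndepFun.charFun_map_fun_finsetSum_eq_prod
        (X := fun k (x : FullData E (N n)) => (√(K : ℝ))⁻¹ *
          (√(N n k * fisherInfo (ν k) (f k) l₀) * (est k (N n k) (x k) - l₀)))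
        (fun k _ => ((hm' k).comp (measurable_pi_apply k)).aemeasurable)
        ((iIndepFun_pi fun k => (hm' k).aemeasurable).restrict _), Finset.prod_apply]
      refine Finset.prod_congr rfl fun k _ => ?_
      rw [← charFun_map_mul_comp (hm k).aemeasurable]
      congr 1
      conv_rhs => rw [← (measurePreserving_eval (fun k =>
        law (blockBase (ν k) (N n k)) (blockDensity (f k) (N n k)) l₀) k).map_eq]
      rw [Measure.map_map (hm' k) (measurable_pi_apply k)]
      rfl
    simp_rw [hchar]
    have hlim : Tendsto (fun n => ∏ k, charFun ((law (blockBase (ν k) (N n k))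
        (blockDensity (f k) (N n k)) l₀).map fun x => √(N n k * fisherInfo (ν k) (f k) l₀) *
          (est k (N n k) x - l₀)) ((√K)⁻¹ * t)) atTop
        (𝓝 (∏ _k : Fin K, charFun (gaussianReal 0 1) ((√K)⁻¹ * t))) :=
      tendsto_finsetProd _ fun k _ =>
        ((hlin k).tendsto_charFun (hf k) (hI k) (hest k) _).comp (hN k)
    convert hlim using 2
    simp only [charFun_gaussianReal, Finset.prod_const, Finset.card_univ, Fintype.card_fin]
    rw [← Complex.exp_nat_mul]
    congr 1
    have h2 : ((√(K : ℝ) : ℝ) : ℂ) ^ 2 = K := by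
      rw [← Complex.ofReal_pow, Real.sq_sqrt hK'.le]; simp
    have h3 : (K : ℂ) ≠ 0 := by exact_mod_cast hK.ne'
    push_cast
    rw [mul_pow, inv_pow, h2]
    field_simp
    ring
  refine ⟨hCR, hvar, ?_⟩
  unfold IsAsymptoticallyEfficient
  simp_rw [hCR]
  exact hvar

end Average

/-! ### A criterion for asymptotic linearity -/

section Criterion

variable {E : Type*} [MeasurableSpace E]

lemma ae_initial {ν : Measure E} [SigmaFinite ν] {f : ℝ → E → ℝ} {l₀ : ℝ}
    (hf : IsScoreRegular ν f l₀) [IsProbabilityMeasure (law ν f l₀)] {m : ℕ}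
    {q : (Fin m → E) → Prop}
    (h : ∀ᵐ x ∂(law (blockBase ν m) (blockDensity f m) l₀), q x) :
    ∀ᵐ ω ∂(Measure.infinitePi fun _ : ℕ => law ν f l₀), q fun i => ω i := by
  rw [hf.law_block m] at h
  exact (measurePreserving_initial _ m).quasiMeasurePreserving.ae h

/-- Chebyshev's inequality for the score sum, whose variance is the Fisher information of the
block. -/
lemma IsScoreRegular.measure_score_sum_le {ν : Measure E} [SigmaFinite ν] {f : ℝ → E → ℝ}
    {l₀ : ℝ} (hf : IsScoreRegular ν f l₀) [IsProbabilityMeasure (law ν f l₀)] (m : ℕ) {c : ℝ}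
    (hc : 0 < c) :
    (Measure.infinitePi fun _ : ℕ => law ν f l₀)
        {ω | c ≤ |∑ i ∈ Finset.range m, score f l₀ (ω i)|} ≤
      ENNReal.ofReal (m * fisherInfo ν f l₀ / c ^ 2) := by
  obtain ⟨hb, hI⟩ := hf.blockDensity m
  have := hb.prob
  have h := meas_ge_le_variance_div_sq hb.memLp_score hc
  rw [variance_of_integral_eq_zero hb.measurable_score.aemeasurable hb.integral_score,
    hb.integral_score] at h
  simp_rw [sub_zero] at h
  rw [← hI]
  refine le_trans (le_of_eq ?_) h
  have hset : MeasurableSet {x | c ≤ |score (BlockMLE.blockDensity f m) l₀ x|} :=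
    measurableSet_le measurable_const (measurable_abs.comp hb.measurable_score)
  rw [hf.law_block m, ← (measurePreserving_initial _ m).measure_preimage
    hset.nullMeasurableSet]
  congr 1
  ext ω
  simp only [Set.mem_ofPred_eq, Set.mem_preimage]
  have h2 := IsScoreRegular.score_pi (μ := fun _ : Fin m => ν) (f := fun _ => f) (fun _ => hf)
    fun i => ω i
  have h3 : score (BlockMLE.blockDensity f m) l₀ (fun i => ω i) =
      ∑ i : Fin m, score f l₀ (ω i) := h2
  rw [h3, Fin.sum_univ_eq_sum_range (fun i => score f l₀ (ω i)) m]

/-- The remainder of an estimator is negligible once, for every `η > 0`, it is at most `η` times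
the standardized score sum outside events of vanishing probability: the standardized score sum
has second moment `1`. -/
lemma isAsymptoticallyLinear_of_remainder_le {ν : Measure E} [SigmaFinite ν] {f : ℝ → E → ℝ}
    {l₀ : ℝ} (hf : IsScoreRegular ν f l₀) (hI : 0 < fisherInfo ν f l₀)
    [IsProbabilityMeasure (law ν f l₀)] {est : ∀ m : ℕ, (Fin m → E) → ℝ}
    (h : ∀ η : ℝ, 0 < η → ∃ B : ℕ → Set (ℕ → E),
      Tendsto (fun m => (Measure.infinitePi fun _ : ℕ => law ν f l₀) (B m)) atTop (𝓝 0) ∧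
      ∀ᶠ m : ℕ in atTop, ∀ᵐ ω ∂(Measure.infinitePi fun _ : ℕ => law ν f l₀), ω ∉ B m →
        |√(m * fisherInfo ν f l₀) * (est m (fun i => ω i) - l₀) -
          (√(m * fisherInfo ν f l₀))⁻¹ * ∑ i ∈ Finset.range m, score f l₀ (ω i)| ≤
        η * |(√(m * fisherInfo ν f l₀))⁻¹ * ∑ i ∈ Finset.range m, score f l₀ (ω i)|) :
    IsAsymptoticallyLinear ν f l₀ est := by
  set Q := Measure.infinitePi fun _ : ℕ => law ν f l₀
  set I := fisherInfo ν f l₀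
  rw [IsAsymptoticallyLinear, tendstoInMeasure_iff_norm]
  intro ε hε
  rw [ENNReal.tendsto_nhds_zero]
  intro γ hγ
  obtain ⟨r, hr0, hrγ⟩ := ENNReal.lt_iff_exists_nnreal_btwn.1 hγ
  have hr : (0 : ℝ) < r := by exact_mod_cast hr0
  -- chosen so that the Chebyshev bound below is `r / 2`
  obtain ⟨B, hB, hbound⟩ := h (ε * √(r / 2)) (by positivity)
  have hB' := (ENNReal.tendsto_nhds_zero.1 hB) (ENNReal.ofReal (r / 2)) (by simpa using hr)
  filter_upwards [hB', hbound, eventually_gt_atTop 0] with m hm1 hm2 hm0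
  have hmI : 0 < m * I := mul_pos (by exact_mod_cast hm0) hI
  have hsq : 0 < √(m * I) := Real.sqrt_pos.2 hmI
  have hη : 0 < √((r : ℝ) / 2) := Real.sqrt_pos.2 (by positivity)
  have htail := hf.measure_score_sum_le m (c := √(m * I) / √((r : ℝ) / 2)) (by positivity)
  have hval : m * I / (√(m * I) / √((r : ℝ) / 2)) ^ 2 = r / 2 := by
    rw [div_pow, Real.sq_sqrt hmI.le, Real.sq_sqrt (by positivity)]
    have : (m : ℝ) ≠ 0 := by exact_mod_cast hm0.ne'
    have : I ≠ 0 := hI.ne'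
    field_simp
  have hval' : (m : ℝ) * fisherInfo ν f l₀ / (√(m * I) / √((r : ℝ) / 2)) ^ 2 = r / 2 := hval
  rw [hval'] at htail
  calc Q _ ≤ Q (B m ∪ {ω | √(m * I) / √((r : ℝ) / 2) ≤
        |∑ i ∈ Finset.range m, score f l₀ (ω i)|}) := by
        refine measure_mono_ae ?_
        filter_upwards [hm2] with ω hω hmem
        by_cases hBω : ω ∈ B m
        · exact Or.inl hBω
        · refine Or.inr ?_
          have h1 : ε ≤ _ := hmem
          rw [Pi.zero_apply, sub_zero, Real.norm_eq_abs] at h1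
          have h2 := h1.trans (hω hBω)
          rw [abs_mul, abs_of_pos (inv_pos.2 hsq)] at h2
          have h3 : √(m * I) / √((r : ℝ) / 2) ≤ |∑ i ∈ Finset.range m, score f l₀ (ω i)| := by
            rw [div_le_iff₀ hη]
            rw [← mul_assoc, mul_comm _ |_|, ← mul_assoc] at h2
            have h4 : ε * √(m * I) ≤
                ε * (|∑ i ∈ Finset.range m, score f l₀ (ω i)| * √((r : ℝ) / 2)) := by
              have := mul_le_mul_of_nonneg_right h2 hsq.le
              refine this.trans (le_of_eq ?_)
              field_simp
            exact le_of_mul_le_mul_left h4 hε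
          exact h3
    _ ≤ ENNReal.ofReal (r / 2) + ENNReal.ofReal (r / 2) :=
        (measure_union_le _ _).trans (add_le_add hm1 htail)
    _ = r := by
        rw [← ENNReal.ofReal_add (by positivity) (by positivity), add_halves,
          ENNReal.ofReal_coe_nnreal]
    _ ≤ γ := hrγ.le

end Criterion

/-! ### Consequences of classical regularity -/

section Calculus

variable {E : Type*} [MeasurableSpace E]

lemma measurable_deriv_param {g : ℝ → E → ℝ} {U : Set ℝ} (hU : IsOpen U)
    (hm : ∀ l ∈ U, Measurable (g l))
    (hd : ∀ x, ∀ l ∈ U, DifferentiableAt ℝ (fun l => g l x) l) {l : ℝ} (hl : l ∈ U) :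
    Measurable fun x => deriv (fun l => g l x) l := by
  classical
  set h : ℕ → ℝ := fun n => 1 / ((n : ℝ) + 1)
  have h0 : Tendsto h atTop (𝓝[≠] 0) :=
    tendsto_nhdsWithin_iff.2 ⟨tendsto_one_div_add_atTop_nhds_zero_nat,
      Eventually.of_forall fun n => (by positivity : (0 : ℝ) < 1 / ((n : ℝ) + 1)).ne'⟩
  have hlU : ∀ᶠ n in atTop, l + h n ∈ U := by
    have : Tendsto (fun n => l + h n) atTop (𝓝 (l + 0)) :=
      (tendsto_nhds_of_tendsto_nhdsWithin h0).const_add l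
    rw [add_zero] at this
    exact this.eventually (hU.mem_nhds hl)
  refine measurable_of_tendsto_metrizable
    (f := fun n x => if l + h n ∈ U then (h n)⁻¹ * (g (l + h n) x - g l x) else 0) (fun n => ?_) ?_
  · by_cases hn : l + h n ∈ U
    · simp only [hn, if_true]
      exact ((hm _ hn).sub (hm _ hl)).const_mul _
    · simp only [hn, if_false]
      exact measurable_const
  · refine tendsto_pi_nhds.2 fun x => ?_
    refine ((hd x l hl).hasDerivAt.tendsto_slope_zero.comp h0).congr' ?_
    filter_upwards [hlU] with n hn
    simp [hn]

/-- Differentiation under the integral sign for a family whose integral does not depend on the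
parameter. -/
lemma integral_deriv_eq_zero {ν : Measure E} {g : ℝ → E → ℝ} {U : Set ℝ} (hU : IsOpen U)
    (hm : ∀ l ∈ U, Measurable (g l)) (hi : ∀ l ∈ U, Integrable (g l) ν)
    (hd : ∀ x, ∀ l ∈ U, DifferentiableAt ℝ (fun l => g l x) l) {b : E → ℝ} (hb : Integrable b ν)
    (hbound : ∀ᵐ x ∂ν, ∀ l ∈ U, |deriv (fun l => g l x) l| ≤ b x) {c : ℝ}
    (hc : ∀ l ∈ U, ∫ x, g l x ∂ν = c) {l : ℝ} (hl : l ∈ U) :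
    Integrable (fun x => deriv (fun l => g l x) l) ν ∧
      ∫ x, deriv (fun l => g l x) l ∂ν = 0 := by
  have hUl := hU.mem_nhds hl
  have h := hasDerivAt_integral_of_dominated_loc_of_deriv_le (μ := ν) (F := g)
    (F' := fun l x => deriv (fun l => g l x) l) hUl
    (by filter_upwards [hUl] with l' hl' using (hm l' hl').aestronglyMeasurable) (hi l hl)
    (measurable_deriv_param hU hm hd hl).aestronglyMeasurable hbound hb
    (ae_of_all _ fun x l' hl' => (hd x l' hl').hasDerivAt)
  refine ⟨h.1, h.2.unique ?_⟩
  refine (hasDerivAt_const l c).congr_of_eventuallyEq ?_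
  filter_upwards [hUl] with l' hl' using hc l' hl'

end Calculus

section Regular

variable {E : Type*} [MeasurableSpace E]

/-- The derivative of the score in the parameter, i.e. the second derivative of the
log-likelihood. -/
noncomputable def scoreDeriv {E : Type*} (f : ℝ → E → ℝ) (l : ℝ) (x : E) : ℝ :=
  deriv (fun l' => score f l' x) l

/-- A classically regular family satisfies the two information identities: its score is centred,
and the expected second derivative of the log-likelihood is minus the Fisher information. -/
lemma IsRegularAt.exists_nhds {ν : Measure E} {f : ℝ → E → ℝ} {Λ : Set ℝ} {l₀ : ℝ}
    (h : IsRegularAt ν f Λ l₀) :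
    IsScoreRegular ν f l₀ ∧ ∃ U : Set ℝ, IsOpen U ∧ l₀ ∈ U ∧ U ⊆ Λ ∧
      (∀ x, ∀ l ∈ U, HasDerivAt (fun l => logLik f l x) (score f l x) l) ∧
      (∀ x, ∀ l ∈ U, HasDerivAt (fun l => score f l x) (scoreDeriv f l x) l) ∧
      (∀ x, ContinuousOn (fun l => scoreDeriv f l x) U) ∧
      (∀ l ∈ U, Measurable (scoreDeriv f l)) ∧
      (∃ M : E → ℝ, Integrable M (law ν f l₀) ∧
        ∀ᵐ x ∂(law ν f l₀), ∀ l ∈ U, |scoreDeriv f l x| ≤ M x) ∧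
      Integrable (scoreDeriv f l₀) (law ν f l₀) ∧
      ∫ x, scoreDeriv f l₀ x ∂(law ν f l₀) = -fisherInfo ν f l₀ := by
  obtain ⟨U, hU, hl₀, hUΛ, hC2, g, M, hg, hM, hdom⟩ := h.smooth
  have hpos l (hl : l ∈ U) x : 0 < f l x := h.pos l (hUΛ hl) x
  have hmeas l (hl : l ∈ U) : Measurable (f l) := h.measurable l (hUΛ hl)
  have hint l (hl : l ∈ U) : Integrable (f l) ν :=
    integrable_of_isProbabilityMeasure_law (hmeas l hl).aestronglyMeasurable
      (fun x => (hpos l hl x).le) (h.prob l (hUΛ hl))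
  have C2deriv {φ : ℝ → ℝ} (hφ : ContDiffOn ℝ 2 φ U) :
      (∀ l ∈ U, DifferentiableAt ℝ φ l) ∧ (∀ l ∈ U, DifferentiableAt ℝ (deriv φ) l) ∧
        ContinuousOn (deriv (deriv φ)) U := by
    have h1 : ContDiffOn ℝ 1 (deriv φ) U := hφ.deriv_of_isOpen hU (by norm_num)
    exact ⟨fun l hl => (hφ.differentiableOn (by norm_num)).differentiableAt (hU.mem_nhds hl),
      fun l hl => (h1.differentiableOn (by norm_num)).differentiableAt (hU.mem_nhds hl),
      h1.continuousOn_deriv_of_isOpen hU (by norm_num)⟩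
  have hlogC2 x : ContDiffOn ℝ 2 (fun l => logLik f l x) U :=
    (hC2 x).log fun l hl => (hpos l hl x).ne'
  have hfd x := C2deriv (hC2 x)
  have hLd x := C2deriv (hlogC2 x)
  have hLmeas l (hl : l ∈ U) : Measurable (logLik f l) := (hmeas l hl).log
  have hsmeas l (hl : l ∈ U) : Measurable (score f l) :=
    measurable_deriv_param hU hLmeas (fun x => (hLd x).1) hl
  have hhmeas l (hl : l ∈ U) : Measurable (scoreDeriv f l) :=
    measurable_deriv_param hU hsmeas (fun x => (hLd x).2.1) hl
  have hac : law ν f l₀ ≪ ν := withDensity_absolutelyContinuous _ _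
  have hMh : ∀ᵐ x ∂(law ν f l₀), ∀ l ∈ U, |scoreDeriv f l x| ≤ M x := by
    filter_upwards [hac.ae_le hdom] with x hx l hl
    have := (hx l hl).2.2
    rwa [iteratedDeriv_succ, iteratedDeriv_one] at this
  -- the derivatives of the density integrate to zero
  have hd1 l (hl : l ∈ U) := integral_deriv_eq_zero hU hmeas hint (fun x => (hfd x).1) hg
    (by filter_upwards [hdom] with x hx l hl using (hx l hl).1)
    (fun l hl => integral_eq_one_of_law (hmeas l hl) (fun x => (hpos l hl x).le)
      (h.prob l (hUΛ hl))) hl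
  have hd2 := integral_deriv_eq_zero (g := fun l x => deriv (fun l' => f l' x) l) hU
    (fun l hl => measurable_deriv_param hU hmeas (fun x => (hfd x).1) hl)
    (fun l hl => (hd1 l hl).1) (fun x => (hfd x).2.1) hg
    (by
      filter_upwards [hdom] with x hx l hl
      have := (hx l hl).2.1
      rwa [iteratedDeriv_succ, iteratedDeriv_one] at this)
    (fun l hl => (hd1 l hl).2) hl₀
  have hscore x l (hl : l ∈ U) : score f l x = deriv (fun l' => f l' x) l / f l x :=
    ((hfd x).1 l hl).hasDerivAt.log (hpos l hl x).ne' |>.deriv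
  have hscoreDeriv x : f l₀ x * (scoreDeriv f l₀ x + score f l₀ x ^ 2) =
      deriv (fun l => deriv (fun l' => f l' x) l) l₀ := by
    have hev : (fun l => score f l x) =ᶠ[𝓝 l₀] fun l => deriv (fun l' => f l' x) l / f l x := by
      filter_upwards [hU.mem_nhds hl₀] with l hl using hscore x l hl
    have hne := (hpos l₀ hl₀ x).ne'
    have hq := ((hfd x).2.1 l₀ hl₀).hasDerivAt.fun_div ((hfd x).1 l₀ hl₀).hasDerivAt hne
    rw [scoreDeriv, hev.deriv_eq, hq.deriv, hscore x l₀ hl₀]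
    field_simp
    ring
  have hs2 : Integrable (fun x => score f l₀ x ^ 2) (law ν f l₀) := by
    -- otherwise the Bochner integral that defines the positive Fisher information would be `0`
    by_contra hcon
    have := h.info_pos
    rw [fisherInfo, integral_undef hcon] at this
    exact lt_irrefl _ this
  have hhint : Integrable (scoreDeriv f l₀) (law ν f l₀) := by
    refine hM.mono' (hhmeas l₀ hl₀).aestronglyMeasurable ?_
    filter_upwards [hMh] with x hx using hx l₀ hl₀
  have hscorereg : IsScoreRegular ν f l₀ := by
    refine ⟨hmeas l₀ hl₀, ?_, h.prob l₀ (hUΛ hl₀), fun x => (hfd x).1 l₀ hl₀, hsmeas l₀ hl₀,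
      (memLp_two_iff_integrable_sq (hsmeas l₀ hl₀).aestronglyMeasurable).2 hs2, ?_⟩
    · filter_upwards [hU.mem_nhds hl₀] with l hl using hpos l hl
    · rw [integral_law (hmeas l₀ hl₀) fun x => (hpos l₀ hl₀ x).le, ← (hd1 l₀ hl₀).2]
      refine integral_congr_ae (ae_of_all _ fun x => ?_)
      have hne := (hpos l₀ hl₀ x).ne'
      simp only [hscore x l₀ hl₀]
      field_simp
  refine ⟨hscorereg, U, hU, hl₀, hUΛ, fun x l hl => ((hLd x).1 l hl).hasDerivAt,
    fun x l hl => ((hLd x).2.1 l hl).hasDerivAt, fun x => (hLd x).2.2, hhmeas, ⟨M, hM, hMh⟩,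
    hhint, ?_⟩
  have hsum : ∫ x, (scoreDeriv f l₀ x + score f l₀ x ^ 2) ∂(law ν f l₀) = 0 := by
    rw [integral_law (hmeas l₀ hl₀) fun x => (hpos l₀ hl₀ x).le, ← hd2.2]
    exact integral_congr_ae (ae_of_all _ hscoreDeriv)
  rw [integral_add hhint hs2] at hsum
  exact eq_neg_of_add_eq_zero_left hsum

/-- Near `l₀` the oscillation of a dominated family that is continuous in the parameter has an
integrable envelope of arbitrarily small mean. -/
lemma exists_oscillation_envelope {P : Measure E} {φ : ℝ → E → ℝ} {U : Set ℝ} {l₀ : ℝ}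
    (hU : IsOpen U) (hl₀ : l₀ ∈ U) (hc : ∀ x, ContinuousOn (fun l => φ l x) U)
    (hm : ∀ l ∈ U, Measurable (φ l)) {M : E → ℝ} (hM : Integrable M P)
    (hdom : ∀ᵐ x ∂P, ∀ l ∈ U, |φ l x| ≤ M x) {η : ℝ} (hη : 0 < η) :
    ∃ δ > 0, Metric.ball l₀ δ ⊆ U ∧ ∃ A : E → ℝ, Measurable A ∧ Integrable A P ∧
      ∫ x, A x ∂P < η ∧ ∀ᵐ x ∂P, ∀ l ∈ Metric.ball l₀ δ, |φ l x - φ l₀ x| ≤ A x := by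
  obtain ⟨r, hr, hrU⟩ := Metric.isOpen_iff.1 hU l₀ hl₀
  set δ : ℕ → ℝ := fun n => r * (1 / ((n : ℝ) + 1))
  have hδ n : 0 < δ n := by positivity
  have hδr n : δ n ≤ r := by
    refine mul_le_of_le_one_right hr.le ?_
    rw [div_le_one (by positivity)]
    simp
  have hδ0 : Tendsto δ atTop (𝓝 0) := by
    have h := (tendsto_one_div_add_atTop_nhds_zero_nat (𝕜 := ℝ)).const_mul r
    rwa [mul_zero] at h
  have hball n : Metric.ball l₀ (δ n) ⊆ U := (Metric.ball_subset_ball (hδr n)).trans hrU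
  -- by continuity the supremum may be taken over rational parameters, so it is measurable
  set A : ℕ → E → ℝ := fun n x =>
    ⨆ q : {q : ℚ // (q : ℝ) ∈ Metric.ball l₀ (δ n)}, |φ q x - φ l₀ x|
  have hAm n : Measurable (A n) := Measurable.iSup fun q =>
    measurable_abs.comp ((hm _ (hball n q.2)).sub (hm _ hl₀))
  have hA0 n x : 0 ≤ A n x := Real.iSup_nonneg fun q => abs_nonneg _
  have hdiff : ∀ᵐ x ∂P, ∀ l ∈ U, |φ l x - φ l₀ x| ≤ 2 * M x := by
    filter_upwards [hdom] with x hx l hl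
    have h1 := abs_sub (φ l x) (φ l₀ x)
    linarith [hx l hl, hx l₀ hl₀]
  have hAM : ∀ᵐ x ∂P, ∀ n, A n x ≤ 2 * M x := by
    filter_upwards [hdiff] with x hx n
    refine Real.iSup_le (fun q => hx _ (hball n q.2)) ?_
    exact (abs_nonneg _).trans (hx l₀ hl₀)
  have hAM' n : ∀ᵐ x ∂P, ‖A n x‖ ≤ 2 * M x := by
    filter_upwards [hAM] with x hx
    rw [Real.norm_of_nonneg (hA0 n x)]
    exact hx n
  have hlim : Tendsto (fun n => ∫ x, A n x ∂P) atTop (𝓝 (∫ _, (0 : ℝ) ∂P)) := by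
    refine tendsto_integral_of_dominated_convergence (fun x => 2 * M x)
      (fun n => (hAm n).aestronglyMeasurable) (hM.const_mul 2) hAM' (ae_of_all _ fun x => ?_)
    rw [Metric.tendsto_atTop]
    intro ε hε
    have hca := (hc x).continuousAt (hU.mem_nhds hl₀)
    obtain ⟨d, hd, hdε⟩ := Metric.continuousAt_iff.1 hca (ε / 2) (by positivity)
    obtain ⟨n₀, hn₀⟩ := (Metric.tendsto_atTop.1 hδ0) d hd
    refine ⟨n₀, fun n hn => ?_⟩
    have hn' := hn₀ n hn
    rw [Real.dist_eq, sub_zero, abs_of_pos (hδ n)] at hn'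
    rw [Real.dist_eq, sub_zero, abs_of_nonneg (hA0 n x)]
    refine lt_of_le_of_lt (Real.iSup_le (fun q => ?_) (by positivity)) (half_lt_self hε)
    exact (hdε ((Metric.mem_ball.1 q.2).trans hn')).le
  rw [integral_zero] at hlim
  obtain ⟨n, hn⟩ := (hlim.eventually (gt_mem_nhds hη)).exists
  refine ⟨δ n, hδ n, hball n, A n, hAm n, ?_, hn, ?_⟩
  · exact (hM.const_mul 2).mono' (hAm n).aestronglyMeasurable (hAM' n)
  filter_upwards [hdiff] with x hx l hl
  have hbdd : BddAbove (Set.range fun q : {q : ℚ // (q : ℝ) ∈ Metric.ball l₀ (δ n)} =>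
      |φ q x - φ l₀ x|) := by
    refine ⟨2 * M x, ?_⟩
    rintro _ ⟨q, rfl⟩
    exact hx _ (hball n q.2)
  -- `l` is a limit of rational parameters in the ball
  have hlcl : l ∈ closure (Metric.ball l₀ (δ n) ∩ Set.range ((↑) : ℚ → ℝ)) :=
    Rat.denseRange_cast.open_subset_closure_inter Metric.isOpen_ball hl
  have hcont : ContinuousWithinAt (fun l => |φ l x - φ l₀ x|)
      (Metric.ball l₀ (δ n) ∩ Set.range ((↑) : ℚ → ℝ)) l :=
    (((hc x).continuousAt (hU.mem_nhds (hball n hl))).sub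
      continuousAt_const).abs.continuousWithinAt
  refine hcont.closure_le hlcl continuousWithinAt_const ?_
  rintro _ ⟨hq, q, rfl⟩
  exact le_ciSup hbdd ⟨q, hq⟩

end Regular

/-! ### Consistent maximum likelihood estimates under classical regularity -/

section Consistent

/-- Expansion of the likelihood equation: `G` is the log-likelihood derivative, with a zero at `t`,
and `b` bounds the variation of its derivative near `l₀`. -/
lemma abs_remainder_le {G G' : ℝ → ℝ} {l₀ t δ b r η : ℝ}
    (hG : ∀ l ∈ Metric.ball l₀ δ, HasDerivAt G (G' l) l) (ht : t ∈ Metric.ball l₀ δ)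
    (h0 : G t = 0) (hb : ∀ l ∈ Metric.ball l₀ δ, |G' l - G' l₀| ≤ b) (hr : 0 < r)
    (hη : 0 ≤ η) (hη1 : η ≤ 1 / 2) (hbr : b + |G' l₀ + r ^ 2| ≤ η * r ^ 2) :
    |r * (t - l₀) - r⁻¹ * G l₀| ≤ 2 * η * |r⁻¹ * G l₀| := by
  have hl₀ : l₀ ∈ Metric.ball l₀ δ := Metric.mem_ball_self (Metric.pos_of_mem_ball ht)
  have h1 : |(G t - G' l₀ * t) - (G l₀ - G' l₀ * l₀)| ≤ b * |t - l₀| :=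
    (convex_ball l₀ δ).norm_image_sub_le_of_norm_hasDerivWithin_le
      (f := fun l => G l - G' l₀ * l) (f' := fun l => G' l - G' l₀)
      (fun l hl => by
        have h := (hG l hl).sub ((hasDerivAt_id l).const_mul (G' l₀))
        rw [mul_one] at h
        exact h.hasDerivWithinAt) hb hl₀ ht
  rw [h0] at h1
  have h2 : |r ^ 2 * (t - l₀) - G l₀| ≤ η * r ^ 2 * |t - l₀| := by
    have h3 : r ^ 2 * (t - l₀) - G l₀ =
        ((0 - G' l₀ * t) - (G l₀ - G' l₀ * l₀)) + (G' l₀ + r ^ 2) * (t - l₀) := by ring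
    rw [h3]
    refine (abs_add_le _ _).trans ?_
    rw [abs_mul]
    calc _ ≤ b * |t - l₀| + |G' l₀ + r ^ 2| * |t - l₀| := by gcongr
      _ = (b + |G' l₀ + r ^ 2|) * |t - l₀| := by ring
      _ ≤ _ := by gcongr
  have h4 : |r * (t - l₀) - r⁻¹ * G l₀| ≤ η * |r * (t - l₀)| := by
    have h5 : r * (t - l₀) - r⁻¹ * G l₀ = r⁻¹ * (r ^ 2 * (t - l₀) - G l₀) := by
      field_simp
    rw [h5, abs_mul, abs_of_pos (inv_pos.2 hr), abs_mul, abs_of_pos hr]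
    calc _ ≤ r⁻¹ * (η * r ^ 2 * |t - l₀|) := by gcongr
      _ = _ := by field_simp
  have h6 : |r * (t - l₀)| ≤ 2 * |r⁻¹ * G l₀| := by
    have h7 := abs_sub_abs_le_abs_sub (r * (t - l₀)) (r⁻¹ * G l₀)
    have h8 : η * |r * (t - l₀)| ≤ 1 / 2 * |r * (t - l₀)| := by gcongr
    linarith
  calc _ ≤ η * |r * (t - l₀)| := h4
    _ ≤ η * (2 * |r⁻¹ * G l₀|) := by gcongr
    _ = _ := by ring

variable {E : Type*} [MeasurableSpace E]

/-- Under classical regularity a consistent maximum likelihood estimator is asymptotically linear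
in the score: it solves the likelihood equation with high probability, and the average second
derivative of the log-likelihood is close to minus the Fisher information near `l₀`. -/
theorem IsRegularAt.isAsymptoticallyLinear {ν : Measure E} [SigmaFinite ν] {f : ℝ → E → ℝ}
    {Λ : Set ℝ} {l₀ : ℝ} (h : IsRegularAt ν f Λ l₀) {est : ∀ m : ℕ, (Fin m → E) → ℝ}
    (hest : ∀ m, Measurable (est m))
    (hmle : ∀ m, ∀ᵐ x ∂(law (blockBase ν m) (blockDensity f m) l₀),
      IsMLE (blockDensity f m) Λ x (est m x))
    (hcons : IsConsistent (fun m => law (blockBase ν m) (blockDensity f m) l₀) est l₀)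
    [IsProbabilityMeasure (law ν f l₀)] : IsAsymptoticallyLinear ν f l₀ est := by
  obtain ⟨hf, U, hU, hl₀, hUΛ, hL, hs, hcont, hhm, ⟨M, hM, hMdom⟩, hhi, hhI⟩ := h.exists_nhds
  set I := fisherInfo ν f l₀
  have hI : 0 < I := h.info_pos
  refine isAsymptoticallyLinear_of_remainder_le hf hI fun η' hη' => ?_
  set η := min (η' / 2) (1 / 2)
  have hη : 0 < η := lt_min (by positivity) (by norm_num)
  obtain ⟨δ, hδ, hδU, A, hAm, hAi, hAη, hAdom⟩ :=
    exists_oscillation_envelope hU hl₀ hcont hhm hM hMdom (η := η * I / 4) (by positivity)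
  set Q := Measure.infinitePi fun _ : ℕ => law ν f l₀
  have hlln1 := tendstoInMeasure_average _ (hhm l₀ hl₀) hhi
  have hlln2 := tendstoInMeasure_average _ hAm hAi
  rw [tendstoInMeasure_iff_norm] at hlln1 hlln2
  have hlln1 := hlln1 (η * I / 2) (by positivity)
  have hlln2 := hlln2 (η * I / 4) (by positivity)
  have hcons' : Tendsto (fun m => Q {ω | δ ≤ |est m (fun i => ω i) - l₀|}) atTop (𝓝 0) := by
    refine (hcons δ hδ).congr fun m => ?_
    beta_reduce
    rw [hf.law_block m]
    have hset : MeasurableSet {x | δ ≤ |est m x - l₀|} :=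
      measurableSet_le measurable_const (measurable_abs.comp ((hest m).sub_const _))
    exact ((measurePreserving_initial _ m).measure_preimage hset.nullMeasurableSet).symm
  refine ⟨fun m => {ω | δ ≤ |est m (fun i => ω i) - l₀|} ∪
    ({ω | η * I / 2 ≤ ‖(∑ i ∈ Finset.range m, scoreDeriv f l₀ (ω i)) / m -
        ∫ x, scoreDeriv f l₀ x ∂(law ν f l₀)‖} ∪
      {ω | η * I / 4 ≤ ‖(∑ i ∈ Finset.range m, A (ω i)) / m - ∫ x, A x ∂(law ν f l₀)‖}),
    ?_, ?_⟩
  · have hsum := hcons'.add (hlln1.add hlln2)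
    simp only [add_zero] at hsum
    refine tendsto_of_tendsto_of_tendsto_of_le_of_le tendsto_const_nhds hsum
      (fun m => bot_le) fun m => ?_
    refine (measure_union_le _ _).trans ?_
    gcongr
    exact measure_union_le _ _
  · filter_upwards [eventually_gt_atTop 0] with m hm0
    have hm : (0 : ℝ) < m := by exact_mod_cast hm0
    have hAall : ∀ᵐ ω ∂Q, ∀ i : ℕ, ∀ l ∈ Metric.ball l₀ δ,
        |scoreDeriv f l (ω i) - scoreDeriv f l₀ (ω i)| ≤ A (ω i) :=
      ae_all_iff.2 fun i => (measurePreserving_eval_infinitePi (fun _ : ℕ => law ν f l₀)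
        i).quasiMeasurePreserving.ae hAdom
    filter_upwards [hAall, ae_initial hf (hmle m)] with ω hω hMLE hB
    simp only [Set.mem_union, Set.mem_ofPred_eq, not_or, not_le] at hB
    obtain ⟨hB1, hB2, hB3⟩ := hB
    set t := est m fun i => ω i
    have htball : t ∈ Metric.ball l₀ δ := by rwa [Metric.mem_ball, Real.dist_eq]
    have hsq : √(m * I) ^ 2 = m * I := Real.sq_sqrt (by positivity)
    -- the estimate is an interior maximum, so it solves the likelihood equation
    have hlik l (hl : l ∈ U) : logLik (blockDensity f m) l (fun i : Fin m => ω i) =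
        ∑ i ∈ Finset.range m, logLik f l (ω i) := by
      rw [← Fin.sum_univ_eq_sum_range (fun i => logLik f l (ω i)) m]
      exact Real.log_prod fun i _ => (h.pos l (hUΛ hl) _).ne'
    have hmax : IsLocalMax (fun l => ∑ i ∈ Finset.range m, logLik f l (ω i)) t := by
      filter_upwards [hU.mem_nhds (hδU htball)] with l hl
      rw [← hlik l hl, ← hlik t (hδU htball)]
      exact hMLE.2 l (hUΛ hl)
    have hzero : ∑ i ∈ Finset.range m, score f t (ω i) = 0 :=
      hmax.hasDerivAt_eq_zero (HasDerivAt.fun_sum fun i _ => hL (ω i) t (hδU htball))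
    have hrem := abs_remainder_le (G := fun l => ∑ i ∈ Finset.range m, score f l (ω i))
      (G' := fun l => ∑ i ∈ Finset.range m, scoreDeriv f l (ω i))
      (b := ∑ i ∈ Finset.range m, A (ω i)) (r := √(m * I)) (η := η)
      (fun l hl => HasDerivAt.fun_sum fun i _ => hs (ω i) l (hδU hl)) htball hzero ?_
      (Real.sqrt_pos.2 (by positivity)) hη.le (min_le_right _ _) ?_
    · refine hrem.trans ?_
      gcongr
      have := min_le_left (η' / 2) (1 / 2)
      linarith
    · intro l hl
      rw [← Finset.sum_sub_distrib]
      exact (Finset.abs_sum_le_sum_abs _ _).trans (Finset.sum_le_sum fun i _ => hω i l hl)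
    · rw [hsq]
      rw [hhI, Real.norm_eq_abs, sub_neg_eq_add] at hB2
      rw [Real.norm_eq_abs] at hB3
      have h1 : |∑ i ∈ Finset.range m, scoreDeriv f l₀ (ω i) + m * I| ≤ η * I / 2 * m := by
        have : ∑ i ∈ Finset.range m, scoreDeriv f l₀ (ω i) + m * I =
            ((∑ i ∈ Finset.range m, scoreDeriv f l₀ (ω i)) / m + I) * m := by field_simp
        rw [this, abs_mul, abs_of_pos hm]
        gcongr
      have h2 : ∑ i ∈ Finset.range m, A (ω i) ≤ η * I / 2 * m := by
        have h3 := (abs_lt.1 hB3).2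
        rw [← div_le_iff₀ hm]
        linarith
      calc _ ≤ η * I / 2 * m + η * I / 2 * m := add_le_add h2 h1
        _ = _ := by ring

end Consistent

/-! ### One-parameter families with an exponentially distributed statistic -/

section ExpStat

variable {E : Type*} [MeasurableSpace E]

/-- On the parameter set `Λ` the densities `f l` are `c (1 + l s)⁻¹ exp (l / (1 + l s) y)`, with
`1 + l s > 0`. As they integrate to `1`, the statistic `y` is exponentially distributed with mean
`s (1 + l s)` at every parameter value `l` interior to `Λ`. -/
structure IsExpFamily (ν : Measure E) (f : ℝ → E → ℝ) (Λ : Set ℝ) (s : ℝ) (c y : E → ℝ) :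
    Prop where
  s_pos : 0 < s
  c_pos : ∀ x, 0 < c x
  measurable_c : Measurable c
  measurable_y : Measurable y
  one_add_pos : ∀ l ∈ Λ, 0 < 1 + l * s
  eq : ∀ l ∈ Λ, ∀ x, f l x = c x * (1 + l * s)⁻¹ * Real.exp (l / (1 + l * s) * y x)
  prob : ∀ l ∈ Λ, IsProbabilityMeasure (law ν f l)

namespace IsExpFamily

variable {ν : Measure E} {f : ℝ → E → ℝ} {Λ : Set ℝ} {s l₀ : ℝ} {c y : E → ℝ}

lemma pos (h : IsExpFamily ν f Λ s c y) {l : ℝ} (hl : l ∈ Λ) (x : E) : 0 < f l x := by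
  rw [h.eq l hl]
  have := h.one_add_pos l hl
  have := h.c_pos x
  positivity

lemma measurable (h : IsExpFamily ν f Λ s c y) {l : ℝ} (hl : l ∈ Λ) : Measurable (f l) := by
  rw [funext (h.eq l hl)]
  exact (h.measurable_c.mul_const _).mul (h.measurable_y.const_mul _).exp

lemma logLik_eq (h : IsExpFamily ν f Λ s c y) {l : ℝ} (hl : l ∈ Λ) (x : E) :
    logLik f l x = Real.log (c x) - Real.log (1 + l * s) + l / (1 + l * s) * y x := by
  have h1 := h.one_add_pos l hl
  have h2 := h.c_pos x
  rw [logLik, h.eq l hl, Real.log_mul (by positivity) (Real.exp_pos _).ne',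
    Real.log_mul h2.ne' (by positivity), Real.log_inv, Real.log_exp]
  ring

/-- Tilting the density at `l₀` by `exp (u y)` gives, up to a constant factor, the density at
another parameter value; this evaluates the moment generating function of `y`. -/
lemma mgf_eventually (h : IsExpFamily ν f Λ s c y) (hl₀ : l₀ ∈ interior Λ) :
    ∀ᶠ u in 𝓝 (0 : ℝ), u ∈ integrableExpSet y (law ν f l₀) ∧
      mgf y (law ν f l₀) u = (1 - s * (1 + l₀ * s) * u)⁻¹ := by
  have hs := h.s_pos
  have hl₀' := interior_subset hl₀
  have hθ := h.one_add_pos l₀ hl₀'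
  set θ := 1 + l₀ * s with hθdef
  have hden : ContinuousAt (fun u : ℝ => 1 - s * θ * u) 0 := by fun_prop
  have hden0 : (1 : ℝ) - s * θ * 0 ≠ 0 := by simp
  -- tilting by `exp (u y)` moves the parameter to `(θ / (1 - s θ u) - 1) / s`, which is near `l₀`
  have hcont : ContinuousAt (fun u : ℝ => (θ * (1 - s * θ * u)⁻¹ - 1) / s) 0 :=
    (((hden.inv₀ hden0).const_mul θ).sub continuousAt_const).div_const s
  have hval : (θ * (1 - s * θ * 0)⁻¹ - 1) / s = l₀ := by
    rw [mul_zero, sub_zero, inv_one, mul_one, hθdef]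
    field_simp
    ring
  have hev1 : ∀ᶠ u in 𝓝 (0 : ℝ), (θ * (1 - s * θ * u)⁻¹ - 1) / s ∈ Λ := by
    refine hcont.eventually_mem ?_
    rw [hval]
    exact mem_interior_iff_mem_nhds.1 hl₀
  have hev2 : ∀ᶠ u in 𝓝 (0 : ℝ), 0 < 1 - s * θ * u := by
    refine hden.eventually (lt_mem_nhds ?_)
    simp
  filter_upwards [hev1, hev2] with u hu1 hu2
  set l := (θ * (1 - s * θ * u)⁻¹ - 1) / s with hldef
  have hθl : 1 + l * s = θ * (1 - s * θ * u)⁻¹ := by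
    rw [hldef]
    field_simp
    ring
  have htilt : l / (1 + l * s) = l₀ / θ + u := by
    have h1 : l₀ = (θ - 1) / s := by rw [hθdef]; field_simp; ring
    have h2 : u = (1 - (1 - s * θ * u)) / (s * θ) := by field_simp; ring
    rw [hθl, hldef, h1]
    generalize 1 - s * θ * u = w at h2 hu2
    rw [h2]
    field_simp
    ring
  have hmgf : mgf y (law ν f l₀) u = (1 - s * θ * u)⁻¹ := by
    rw [mgf, integral_law (h.measurable hl₀') fun x => (h.pos hl₀' x).le]
    have hpt x : f l₀ x * Real.exp (u * y x) = (1 - s * θ * u)⁻¹ * f l x := by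
      rw [h.eq l₀ hl₀', h.eq l hu1, htilt, hθl, add_mul (l₀ / θ), Real.exp_add, ← hθdef]
      generalize 1 - s * θ * u = w at hu2
      field_simp
    simp_rw [hpt]
    rw [integral_const_mul, integral_eq_one_of_law (h.measurable hu1)
      (fun x => (h.pos hu1 x).le) (h.prob l hu1), mul_one]
  refine ⟨?_, hmgf⟩
  -- a nonzero Bochner integral has an integrable integrand
  by_contra hcon
  have h0 : mgf y (law ν f l₀) u = 0 := integral_undef hcon
  rw [hmgf] at h0
  exact (inv_pos.2 hu2).ne' h0

lemma zero_mem_interior (h : IsExpFamily ν f Λ s c y) (hl₀ : l₀ ∈ interior Λ) :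
    0 ∈ interior (integrableExpSet y (law ν f l₀)) :=
  mem_interior_iff_mem_nhds.2 ((h.mgf_eventually hl₀).mono fun _ hu => hu.1)

lemma memLp_y (h : IsExpFamily ν f Λ s c y) (hl₀ : l₀ ∈ interior Λ) :
    MemLp y 2 (law ν f l₀) :=
  memLp_of_mem_interior_integrableExpSet (h.zero_mem_interior hl₀) 2

lemma moments (h : IsExpFamily ν f Λ s c y) (hl₀ : l₀ ∈ interior Λ) :
    ∫ x, y x ∂(law ν f l₀) = s * (1 + l₀ * s) ∧
      ∫ x, y x ^ 2 ∂(law ν f l₀) = 2 * (s * (1 + l₀ * s)) ^ 2 := by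
  set κ := s * (1 + l₀ * s)
  have hmgf : mgf y (law ν f l₀) =ᶠ[𝓝 0] fun u => (1 - κ * u)⁻¹ :=
    (h.mgf_eventually hl₀).mono fun _ hu => hu.2
  have hd u (hu : 1 - κ * u ≠ 0) : HasDerivAt (fun u : ℝ => 1 - κ * u) (-κ) u := by
    simpa using ((hasDerivAt_id u).const_mul κ).const_sub 1
  have hne : ∀ᶠ u in 𝓝 (0 : ℝ), 1 - κ * u ≠ 0 := by
    have : ContinuousAt (fun u : ℝ => 1 - κ * u) 0 := by fun_prop
    exact this.eventually_ne (by simp)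
  have hderiv : deriv (mgf y (law ν f l₀)) =ᶠ[𝓝 0] fun u => κ * ((1 - κ * u)⁻¹) ^ 2 := by
    refine hmgf.deriv.trans ?_
    filter_upwards [hne] with u hu
    rw [((hd u hu).fun_inv hu).deriv]
    field_simp
  have h0 : (1 : ℝ) - κ * 0 ≠ 0 := by simp
  have hderiv2 : deriv (deriv (mgf y (law ν f l₀))) 0 = 2 * κ ^ 2 := by
    rw [hderiv.deriv_eq, ((((hd 0 h0).fun_inv h0).fun_pow 2).const_mul κ).deriv]
    simp
    ring
  have h1 := iteratedDeriv_mgf_zero (h.zero_mem_interior hl₀) 1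
  have h2 := iteratedDeriv_mgf_zero (h.zero_mem_interior hl₀) 2
  rw [iteratedDeriv_one, hderiv.self_of_nhds] at h1
  rw [iteratedDeriv_succ, iteratedDeriv_one, hderiv2] at h2
  simp only [Pi.pow_apply, pow_one, mul_zero, sub_zero, inv_one, one_pow, mul_one] at h1 h2
  exact ⟨h1.symm, h2.symm⟩

lemma score_eq (h : IsExpFamily ν f Λ s c y) (hl₀ : l₀ ∈ interior Λ) (x : E) :
    score f l₀ x = (y x - s * (1 + l₀ * s)) / (1 + l₀ * s) ^ 2 := by
  have hθ := h.one_add_pos l₀ (interior_subset hl₀)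
  have hev : (fun l => logLik f l x) =ᶠ[𝓝 l₀] fun l =>
      Real.log (c x) - Real.log (1 + l * s) + l / (1 + l * s) * y x := by
    filter_upwards [mem_interior_iff_mem_nhds.1 hl₀] with l hl using h.logLik_eq hl x
  have hlin : HasDerivAt (fun l : ℝ => 1 + l * s) s l₀ := by
    simpa using ((hasDerivAt_id l₀).mul_const s).const_add 1
  have hd := ((hlin.log hθ.ne').const_sub (Real.log (c x))).add
    (((hasDerivAt_id l₀).div hlin hθ.ne').mul_const (y x))
  rw [score, hev.deriv_eq]
  refine hd.deriv.trans ?_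
  simp only [id]
  field_simp
  ring

lemma isScoreRegular (h : IsExpFamily ν f Λ s c y) (hl₀ : l₀ ∈ interior Λ) :
    IsScoreRegular ν f l₀ ∧ fisherInfo ν f l₀ = s ^ 2 / (1 + l₀ * s) ^ 2 := by
  have hl₀' := interior_subset hl₀
  have hθ := h.one_add_pos l₀ hl₀'
  have hP := h.prob l₀ hl₀'
  obtain ⟨hm1, hm2⟩ := h.moments hl₀
  have hL := h.memLp_y hl₀
  have hyi : Integrable y (law ν f l₀) := hL.integrable (by norm_num)
  have hyi2 : Integrable (fun x => y x ^ 2) (law ν f l₀) := hL.integrable_sq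
  have hsc : score f l₀ = fun x => (y x - s * (1 + l₀ * s)) / (1 + l₀ * s) ^ 2 :=
    funext (h.score_eq hl₀)
  refine ⟨⟨h.measurable hl₀', ?_, hP, fun x => ?_, ?_, ?_, ?_⟩, ?_⟩
  · filter_upwards [mem_interior_iff_mem_nhds.1 hl₀] with l hl using h.pos hl
  · have hev : (fun l => f l x) =ᶠ[𝓝 l₀] fun l =>
        c x * (1 + l * s)⁻¹ * Real.exp (l / (1 + l * s) * y x) := by
      filter_upwards [mem_interior_iff_mem_nhds.1 hl₀] with l hl using h.eq l hl x
    refine DifferentiableAt.congr_of_eventuallyEq ?_ hev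
    have hlin : DifferentiableAt ℝ (fun l : ℝ => 1 + l * s) l₀ := by fun_prop
    exact ((hlin.fun_inv hθ.ne').const_mul _).mul
      ((differentiableAt_id.div hlin hθ.ne').mul_const _).exp
  · rw [hsc]
    exact (h.measurable_y.sub_const _).div_const _
  · rw [hsc]
    simp_rw [div_eq_mul_inv]
    exact (hL.sub (memLp_const _)).mul_const _
  · rw [hsc, integral_div, integral_sub hyi (integrable_const _), hm1]
    simp
  · rw [fisherInfo, hsc]
    have hpt x : ((y x - s * (1 + l₀ * s)) / (1 + l₀ * s) ^ 2) ^ 2 =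
        (y x ^ 2 - 2 * (s * (1 + l₀ * s)) * y x + (s * (1 + l₀ * s)) ^ 2) /
          (1 + l₀ * s) ^ 4 := by
      field_simp
      ring
    simp_rw [hpt]
    have hi : Integrable (fun x => y x ^ 2 - 2 * (s * (1 + l₀ * s)) * y x) (law ν f l₀) :=
      hyi2.sub (hyi.const_mul _)
    rw [integral_div, integral_add hi (integrable_const _),
      integral_sub hyi2 (hyi.const_mul _), integral_const_mul, hm1, hm2]
    simp only [integral_const, probReal_univ, one_smul]
    field_simp
    ring

/-- The log-likelihood of a block, with mean `A s` of `y` over the block, is up to a constant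
`m (- log θ - A / θ)` with `θ = 1 + l s`, which has its only maximum at `θ = A`. -/
lemma isMLE_eq (h : IsExpFamily ν f Λ s c y) {m : ℕ} (hm : 0 < m) {x : Fin m → E} {t A : ℝ}
    (ht : IsMLE (blockDensity f m) Λ x t) (hA : ∑ i, y (x i) = m * (s * A))
    (hAΛ : (A - 1) / s ∈ Λ) : t = (A - 1) / s := by
  have hs := h.s_pos
  have hm' : (0 : ℝ) < m := by exact_mod_cast hm
  have hlik l (hl : l ∈ Λ) : logLik (blockDensity f m) l x =
      ∑ i, Real.log (c (x i)) + m * (A - Real.log (1 + l * s) - A / (1 + l * s)) := by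
    have h1 : logLik (blockDensity f m) l x = ∑ i, logLik f l (x i) :=
      Real.log_prod fun i _ => (h.pos hl _).ne'
    rw [h1]
    simp_rw [h.logLik_eq hl]
    rw [Finset.sum_add_distrib, Finset.sum_sub_distrib, ← Finset.mul_sum, hA, Finset.sum_const,
      Finset.card_univ, Fintype.card_fin, nsmul_eq_mul]
    have := (h.one_add_pos l hl).ne'
    field_simp
    ring
  have hθA : 1 + (A - 1) / s * s = A := by field_simp; ring
  have hA0 := h.one_add_pos _ hAΛ
  rw [hθA] at hA0
  have hθt := h.one_add_pos t ht.1
  have hle := ht.2 _ hAΛ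
  rw [hlik t ht.1, hlik _ hAΛ, hθA, div_self hA0.ne'] at hle
  have hle' := le_of_mul_le_mul_left ((add_le_add_iff_left _).1 hle) hm'
  have hθ : A / (1 + t * s) = 1 := by
    by_contra hne
    have h1 := Real.log_lt_sub_one_of_pos (div_pos hA0 hθt) hne
    rw [Real.log_div hA0.ne' hθt.ne'] at h1
    linarith
  rw [div_eq_one_iff_eq hθt.ne'] at hθ
  rw [hθ]
  field_simp
  ring

/-- No consistency is assumed: with probability tending to `1` the unrestricted maximizer of the
likelihood lies in `Λ`, and then the estimate equals it and the remainder vanishes. -/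
theorem isAsymptoticallyLinear [SigmaFinite ν] (h : IsExpFamily ν f Λ s c y)
    (hl₀ : l₀ ∈ interior Λ) {est : ∀ m : ℕ, (Fin m → E) → ℝ}
    (hmle : ∀ m, ∀ᵐ x ∂(law (blockBase ν m) (blockDensity f m) l₀),
      IsMLE (blockDensity f m) Λ x (est m x))
    [IsProbabilityMeasure (law ν f l₀)] : IsAsymptoticallyLinear ν f l₀ est := by
  obtain ⟨hf, hI⟩ := h.isScoreRegular hl₀
  have hs := h.s_pos
  have hθ := h.one_add_pos l₀ (interior_subset hl₀)
  have hI0 : 0 < fisherInfo ν f l₀ := by rw [hI]; positivity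
  obtain ⟨δ, hδ, hδΛ⟩ := Metric.mem_nhds_iff.1 (mem_interior_iff_mem_nhds.1 hl₀)
  have hlln := tendstoInMeasure_average _ h.measurable_y ((h.memLp_y hl₀).integrable (by norm_num))
  rw [tendstoInMeasure_iff_norm] at hlln
  -- with mean `ȳ` the maximizer `(ȳ / s - 1) / s` is at distance `|ȳ - s θ| / s ^ 2` from `l₀`
  have hlln := hlln (δ * s ^ 2) (by positivity)
  refine isAsymptoticallyLinear_of_remainder_le hf hI0 fun η hη => ⟨_, hlln, ?_⟩
  filter_upwards [eventually_gt_atTop 0] with m hm0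
  have hm : (0 : ℝ) < m := by exact_mod_cast hm0
  filter_upwards [ae_initial hf (hmle m)] with ω hMLE hB
  simp only [not_le] at hB
  rw [(h.moments hl₀).1, Real.norm_eq_abs] at hB
  set Y := ∑ i ∈ Finset.range m, y (ω i) with hY
  have ht : est m (fun i => ω i) = (Y / m / s - 1) / s := by
    refine h.isMLE_eq hm0 hMLE ?_ (hδΛ ?_)
    · rw [Fin.sum_univ_eq_sum_range (fun i => y (ω i)) m, ← hY]
      field_simp
    · rw [Metric.mem_ball, Real.dist_eq]
      have h1 : (Y / m / s - 1) / s - l₀ = (Y / m - s * (1 + l₀ * s)) / s ^ 2 := by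
        field_simp
        ring
      rwa [h1, abs_div, abs_of_pos (by positivity : 0 < s ^ 2), div_lt_iff₀ (by positivity)]
  have hr : 0 < √(m * fisherInfo ν f l₀) := Real.sqrt_pos.2 (by positivity)
  have hr2 : √(m * fisherInfo ν f l₀) ^ 2 = m * (s ^ 2 / (1 + l₀ * s) ^ 2) := by
    rw [Real.sq_sqrt (by positivity), hI]
  have hzero : √(m * fisherInfo ν f l₀) * (est m (fun i => ω i) - l₀) -
      (√(m * fisherInfo ν f l₀))⁻¹ * ∑ i ∈ Finset.range m, score f l₀ (ω i) = 0 := by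
    simp_rw [h.score_eq hl₀]
    rw [← Finset.sum_div, Finset.sum_sub_distrib, ← hY, Finset.sum_const, Finset.card_range,
      nsmul_eq_mul, ht]
    set r := √(m * fisherInfo ν f l₀)
    rw [sub_eq_zero, eq_inv_mul_iff_mul_eq₀ hr.ne', ← mul_assoc, ← pow_two, hr2]
    field_simp
    ring
  rw [hzero, abs_zero]
  positivity

end IsExpFamily

end ExpStat

/-! ### The circular complex Gaussian density of a single source -/

section Gaussian

open Matrix

variable {p : ℕ}

open scoped MatrixOrder Matrix.Norms.L2Operator in
lemma exists_eq_conjTranspose_mul_self {R : Matrix (Fin p) (Fin p) ℂ} (hR : R.PosSemidef) :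
    ∃ B : Matrix (Fin p) (Fin p) ℂ, R = Bᴴ * B :=
  (CStarAlgebra.nonneg_iff_eq_star_mul_self (a := R)).1 hR.nonneg

lemma integral_exp_neg_sum_norm_sq :
    ∫ z : Fin p → ℂ, Real.exp (-∑ i, ‖z i‖ ^ 2) = Real.pi ^ p := by
  have h1 : ∫ z : ℂ, Real.exp (-‖z‖ ^ 2) = Real.pi := by
    have h := Complex.integral_exp_neg_rpow (p := 2) (by norm_num)
    have h2 : (2 : ℝ) / 2 + 1 = 2 := by norm_num
    rw [h2, Real.Gamma_two, mul_one] at h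
    rw [← h]
    refine integral_congr_ae (ae_of_all _ fun z => ?_)
    simp
  simp_rw [← Finset.sum_neg_distrib, Real.exp_sum]
  rw [integral_fintype_prod_volume_eq_pow (fun z : ℂ => Real.exp (-‖z‖ ^ 2)), h1,
    Fintype.card_fin]

lemma det_restrictScalars_toLin' (B : Matrix (Fin p) (Fin p) ℂ) :
    LinearMap.det ((Matrix.toLin' B).restrictScalars ℝ) = Complex.normSq B.det := by
  rw [LinearMap.det_restrictScalars, LinearMap.det_toLin', Algebra.norm_complex_apply]

/-- The substitution `z = B x` with `R⁻¹ = Bᴴ B`, whose real Jacobian is `|det B| ^ 2`, reduces the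
Gaussian integral to a product of integrals over `ℂ`. -/
lemma integral_complexGaussianDensity {R : Matrix (Fin p) (Fin p) ℂ} (hR : R.PosDef) :
    ∫ x, complexGaussianDensity R x = 1 := by
  obtain ⟨B, hB⟩ := exists_eq_conjTranspose_mul_self hR.inv.posSemidef
  have hdetR := hR.det_pos
  have hdetRre : 0 < R.det.re := (Complex.pos_iff.1 hdetR).1
  have hdetR' : R.det = (R.det.re : ℂ) :=
    Complex.ext rfl (by simpa using (Complex.pos_iff.1 hdetR).2.symm)
  have hdetB : Complex.normSq B.det = (R.det.re)⁻¹ := by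
    have h1 : (R⁻¹).det = star B.det * B.det := by
      rw [hB, det_mul, det_conjTranspose]
    rw [det_nonsing_inv, Ring.inverse_eq_inv', hdetR'] at h1
    have h2 : ((Complex.normSq B.det : ℝ) : ℂ) = (((R.det.re)⁻¹ : ℝ) : ℂ) := by
      rw [Complex.normSq_eq_conj_mul_self, Complex.ofReal_inv, h1]
      rfl
    exact_mod_cast h2
  have hquad x : (star x ⬝ᵥ (R⁻¹ *ᵥ x)).re = ∑ i, ‖(B *ᵥ x) i‖ ^ 2 := by
    rw [hB, ← mulVec_mulVec, dotProduct_mulVec, ← star_mulVec, dotProduct, Complex.re_sum]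
    refine Finset.sum_congr rfl fun i _ => ?_
    rw [Pi.star_apply, ← Complex.normSq_eq_norm_sq, ← Complex.ofReal_re (Complex.normSq _),
      Complex.normSq_eq_conj_mul_self]
    rfl
  set L := (Matrix.toLin' B).restrictScalars ℝ
  have hL : LinearMap.det L = (R.det.re)⁻¹ := by rw [det_restrictScalars_toLin', hdetB]
  have hLne : LinearMap.det L ≠ 0 := by rw [hL]; positivity
  have hmap := Measure.map_linearMap_addHaar_eq_smul_addHaar
    (volume : Measure (Fin p → ℂ)) hLne
  rw [hL, inv_inv, abs_of_pos hdetRre] at hmap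
  have hLc : Continuous L := LinearMap.continuous_of_finiteDimensional L
  have hint : ∫ x, Real.exp (-∑ i, ‖(L x) i‖ ^ 2) = R.det.re * Real.pi ^ p := by
    have h := integral_map (μ := volume) (φ := L) (f := fun z : Fin p → ℂ =>
      Real.exp (-∑ i, ‖z i‖ ^ 2)) hLc.measurable.aemeasurable
      (Continuous.aestronglyMeasurable (by fun_prop))
    rw [← h, hmap, integral_smul_measure, integral_exp_neg_sum_norm_sq,
      ENNReal.toReal_ofReal hdetRre.le, smul_eq_mul]
  have hpt x : complexGaussianDensity R x =
      1 / (Real.pi ^ p * R.det.re) * Real.exp (-∑ i, ‖(L x) i‖ ^ 2) := by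
    rw [complexGaussianDensity, hquad]
    rfl
  simp_rw [hpt]
  rw [integral_const_mul, hint]
  have := Real.pi_pos
  field_simp

variable (a : Fin p → ℂ) (C : Matrix (Fin p) (Fin p) ℂ)

/-- The signal-to-noise ratio `aᴴ C⁻¹ a` per unit of source power. -/
noncomputable def sourceSnr : ℝ := (star a ⬝ᵥ (C⁻¹ *ᵥ a)).re

/-- The power `|aᴴ C⁻¹ x| ^ 2` of the sample `x` after whitening and matched filtering, a
sufficient statistic for the source power. -/
noncomputable def sourceStat (x : Fin p → ℂ) : ℝ := ‖star (C⁻¹ *ᵥ a) ⬝ᵥ x‖ ^ 2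

variable {a C}

lemma sourceSnr_pos (ha : a ≠ 0) (hC : C.PosDef) : 0 < sourceSnr a C :=
  (Complex.pos_iff.1 (hC.inv.dotProduct_mulVec_pos ha)).1

lemma ofReal_sourceSnr (ha : a ≠ 0) (hC : C.PosDef) :
    (sourceSnr a C : ℂ) = star a ⬝ᵥ (C⁻¹ *ᵥ a) :=
  Complex.ext rfl (by simpa using (Complex.pos_iff.1 (hC.inv.dotProduct_mulVec_pos ha)).2)

lemma det_sourceCov (ha : a ≠ 0) (hC : C.PosDef) (l : ℝ) :
    (sourceCov a C l).det = C.det * (1 + l * sourceSnr a C : ℝ) := by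
  have hu : IsUnit C.det := (isUnit_iff_isUnit_det C).1 hC.isUnit
  have h1 : sourceCov a C l = C * (1 + replicateCol Unit ((l : ℂ) • (C⁻¹ *ᵥ a)) *
      replicateRow Unit (star a)) := by
    rw [← vecMulVec_eq, mul_add, mul_one, mul_vecMulVec, mulVec_smul, mulVec_mulVec,
      mul_nonsing_inv _ hu, one_mulVec, smul_vecMulVec, sourceCov, add_comm]
  rw [h1, det_mul, det_one_add_replicateCol_mul_replicateRow, dotProduct_smul, smul_eq_mul,
    ← ofReal_sourceSnr ha hC]
  push_cast
  rfl

lemma one_add_mul_sourceSnr_pos (ha : a ≠ 0) (hC : C.PosDef) {l : ℝ}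
    (hl : (sourceCov a C l).PosDef) : 0 < 1 + l * sourceSnr a C := by
  have h := hl.det_pos
  rw [det_sourceCov ha hC] at h
  exact_mod_cast (pos_iff_pos_of_mul_pos h).1 hC.det_pos

/-- The Sherman–Morrison formula for the inverse covariance. -/
lemma inv_sourceCov (ha : a ≠ 0) (hC : C.PosDef) {l : ℝ} (hl : 1 + l * sourceSnr a C ≠ 0) :
    (sourceCov a C l)⁻¹ = C⁻¹ - ((l / (1 + l * sourceSnr a C) : ℝ) : ℂ) •
      vecMulVec (C⁻¹ *ᵥ a) (star (C⁻¹ *ᵥ a)) := by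
  have hu : IsUnit C.det := (isUnit_iff_isUnit_det C).1 hC.isUnit
  have hw : star (C⁻¹ *ᵥ a) = star a ᵥ* C⁻¹ := by
    rw [star_mulVec, hC.inv.isHermitian.eq]
  refine inv_eq_right_inv ?_
  have h1 : vecMulVec a (star a) * vecMulVec (C⁻¹ *ᵥ a) (star (C⁻¹ *ᵥ a)) =
      (sourceSnr a C : ℂ) • vecMulVec a (star (C⁻¹ *ᵥ a)) := by
    rw [vecMulVec_mul_vecMulVec, ofReal_sourceSnr ha hC, vecMulVec_smul]
  have h2 : C * vecMulVec (C⁻¹ *ᵥ a) (star (C⁻¹ *ᵥ a)) = vecMulVec a (star (C⁻¹ *ᵥ a)) := by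
    rw [mul_vecMulVec, mulVec_mulVec, mul_nonsing_inv _ hu, one_mulVec]
  have h3 : vecMulVec a (star a) * C⁻¹ = vecMulVec a (star (C⁻¹ *ᵥ a)) := by
    rw [vecMulVec_mul, hw]
  rw [sourceCov, mul_sub, add_mul, smul_mul_assoc, h3, mul_nonsing_inv _ hu, mul_smul_comm,
    add_mul, smul_mul_assoc, h1, h2]
  have hl' : (1 : ℂ) + l * sourceSnr a C ≠ 0 := by exact_mod_cast hl
  have h4 : (l : ℂ) - ((l / (1 + l * sourceSnr a C) : ℝ) : ℂ) * (l * sourceSnr a C + 1) = 0 := by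
    push_cast
    field_simp
    ring
  calc _ = 1 + ((l : ℂ) - ((l / (1 + l * sourceSnr a C) : ℝ) : ℂ) * (l * sourceSnr a C + 1)) •
        vecMulVec a (star (C⁻¹ *ᵥ a)) := by module
    _ = 1 := by rw [h4, zero_smul, add_zero]

/-- The density of a single source is the density of the noise alone times a factor that depends on
the sample only through the matched filter power. -/
lemma sourceDensity_eq (ha : a ≠ 0) (hC : C.PosDef) {l : ℝ} (hl : (sourceCov a C l).PosDef)
    (x : Fin p → ℂ) :
    sourceDensity a C l x = complexGaussianDensity C x * (1 + l * sourceSnr a C)⁻¹ *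
      Real.exp (l / (1 + l * sourceSnr a C) * sourceStat a C x) := by
  have hθ := one_add_mul_sourceSnr_pos ha hC hl
  have hstat : star x ⬝ᵥ (vecMulVec (C⁻¹ *ᵥ a) (star (C⁻¹ *ᵥ a)) *ᵥ x) =
      (sourceStat a C x : ℂ) := by
    rw [vecMulVec_mulVec, op_smul_eq_smul, dotProduct_smul, smul_eq_mul, sourceStat,
      ← Complex.normSq_eq_norm_sq, Complex.normSq_eq_conj_mul_self, mul_comm]
    congr 1
    exact star_dotProduct x (C⁻¹ *ᵥ a)
  rw [sourceDensity, complexGaussianDensity, complexGaussianDensity,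
    inv_sourceCov ha hC hθ.ne', sub_mulVec, dotProduct_sub, smul_mulVec, dotProduct_smul, hstat,
    det_sourceCov ha hC, Complex.re_mul_ofReal, Complex.sub_re, smul_eq_mul, Complex.re_ofReal_mul,
    Complex.ofReal_re, neg_sub, sub_eq_neg_add, Real.exp_add]
  field_simp

lemma continuous_complexGaussianDensity (R : Matrix (Fin p) (Fin p) ℂ) :
    Continuous (complexGaussianDensity R) := by
  unfold complexGaussianDensity
  fun_prop

lemma complexGaussianDensity_pos {R : Matrix (Fin p) (Fin p) ℂ} (hR : R.PosDef)
    (x : Fin p → ℂ) : 0 < complexGaussianDensity R x := by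
  have h1 : 0 < R.det.re := (Complex.pos_iff.1 hR.det_pos).1
  have := Real.pi_pos
  unfold complexGaussianDensity
  positivity

lemma isProbabilityMeasure_law_sourceDensity {l : ℝ} (hl : (sourceCov a C l).PosDef) :
    IsProbabilityMeasure (law volume (sourceDensity a C) l) := by
  have h1 : ∫ x, sourceDensity a C l x = 1 := integral_complexGaussianDensity hl
  have hint : Integrable (sourceDensity a C l) := by
    by_contra hcon
    rw [integral_undef hcon] at h1
    exact zero_ne_one h1
  refine ⟨?_⟩
  rw [law, withDensity_apply _ MeasurableSet.univ, Measure.restrict_univ,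
    ← ofReal_integral_eq_lintegral_ofReal hint
      (ae_of_all _ fun x => (complexGaussianDensity_pos hl x).le), h1, ENNReal.ofReal_one]

lemma isExpFamily_sourceDensity (ha : a ≠ 0) (hC : C.PosDef) {Λ : Set ℝ}
    (hΛ : ∀ l ∈ Λ, (sourceCov a C l).PosDef) :
    IsExpFamily volume (sourceDensity a C) Λ (sourceSnr a C) (complexGaussianDensity C)
      (sourceStat a C) where
  s_pos := sourceSnr_pos ha hC
  c_pos := complexGaussianDensity_pos hC
  measurable_c := (continuous_complexGaussianDensity C).measurable
  measurable_y := by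
    refine Continuous.measurable ?_
    unfold sourceStat
    fun_prop
  one_add_pos l hl := one_add_mul_sourceSnr_pos ha hC (hΛ l hl)
  eq l hl := sourceDensity_eq ha hC (hΛ l hl)
  prob l hl := isProbabilityMeasure_law_sourceDensity (hΛ l hl)

end Gaussian

end BlockMLE

/-! ### The two cases -/

/-- Averaging of per-block maximum likelihood estimates. The first part is for general block
likelihoods, the second for the power of a single source in colored Gaussian noise. -/
theorem mainTheorem1
    (K : ℕ) (hK : 0 < K)
    -- block sizes at stage `n`, all tending to infinity; parameter sets; true value
    (N : ℕ → Fin K → ℕ) (hN : ∀ k, Tendsto (fun n => N n k) atTop atTop)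
    (Λ : Fin K → Set ℝ) (l₀ : ℝ) (hl₀ : ∀ k, l₀ ∈ interior (Λ k))
    (J : ℕ → ℝ) :
    (∀ (E : Fin K → Type u) [∀ k, MeasurableSpace (E k)]
        (ν : ∀ k, Measure (E k)) [∀ k, SigmaFinite (ν k)]
        (f : ∀ k, ℝ → E k → ℝ)
        (_ : ∀ k, BlockMLE.IsRegularAt (ν k) (f k) (Λ k) l₀)
        -- the full likelihood, whose logarithm is the sum of the block log-likelihoods
        (p : ∀ n, ℝ → BlockMLE.FullData E (N n) → ℝ)
        (_ : ∀ n, ∀ l ∈ ⋂ k, Λ k, ∀ x, 0 < p n l x)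
        (_ : ∀ n, ∀ l ∈ ⋂ k, Λ k, ∀ x, BlockMLE.logLik (p n) l x =
          ∑ k, BlockMLE.logLik (BlockMLE.blockDensity (f k) (N n k)) l (x k))
        -- the per-block maximum likelihood estimators
        (est : ∀ k : Fin K, ∀ m : ℕ, (Fin m → E k) → ℝ)
        (_ : ∀ k m, Measurable (est k m))
        (_ : ∀ k m, ∀ᵐ x ∂(BlockMLE.law (BlockMLE.blockBase (ν k) m)
            (BlockMLE.blockDensity (f k) m) l₀),
          BlockMLE.IsMLE (BlockMLE.blockDensity (f k) m) (Λ k) x (est k m x))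
        (_ : ∀ k, BlockMLE.IsConsistent (fun m => BlockMLE.law (BlockMLE.blockBase (ν k) m)
            (BlockMLE.blockDensity (f k) m) l₀) (est k) l₀)
        -- all blocks have the same Fisher information
        (_ : ∀ n k, BlockMLE.fisherInfo (BlockMLE.blockBase (ν k) (N n k))
            (BlockMLE.blockDensity (f k) (N n k)) l₀ = J n),
      (∀ n, BlockMLE.crBound (BlockMLE.fullBase ν (N n)) (p n) l₀ = 1 / (K * J n)) ∧
      BlockMLE.HasAsymptoticVariance (fun n => BlockMLE.law (BlockMLE.fullBase ν (N n)) (p n) l₀)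
        (fun n => BlockMLE.averageEst est (N n)) l₀ (fun n => 1 / (K * J n)) ∧
      BlockMLE.IsAsymptoticallyEfficient (fun n => BlockMLE.fullBase ν (N n)) p
        (fun n => BlockMLE.averageEst est (N n)) l₀) ∧
    (∀ (p : ℕ) (a : Fin K → Fin p → ℂ) (_ : ∀ k, a k ≠ 0)
        (C : Fin K → Matrix (Fin p) (Fin p) ℂ) (_ : ∀ k, (C k).PosDef)
        (_ : ∀ k, ∀ l ∈ Λ k, (BlockMLE.sourceCov (a k) (C k) l).PosDef)
        (est : Fin K → ∀ m : ℕ, (Fin m → Fin p → ℂ) → ℝ)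
        (_ : ∀ k m, Measurable (est k m))
        (_ : ∀ k m, ∀ᵐ x ∂(BlockMLE.law (BlockMLE.blockBase volume m)
            (BlockMLE.blockDensity (BlockMLE.sourceDensity (a k) (C k)) m) l₀),
          BlockMLE.IsMLE (BlockMLE.blockDensity (BlockMLE.sourceDensity (a k) (C k)) m) (Λ k) x
            (est k m x))
        (_ : ∀ n k, BlockMLE.fisherInfo (BlockMLE.blockBase volume (N n k))
            (BlockMLE.blockDensity (BlockMLE.sourceDensity (a k) (C k)) (N n k)) l₀ = J n),
      (∀ n, BlockMLE.crBound (BlockMLE.fullBase (fun _ => volume) (N n))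
          (BlockMLE.fullDensity (fun k => BlockMLE.sourceDensity (a k) (C k)) (N n)) l₀ =
        1 / (K * J n)) ∧
      BlockMLE.HasAsymptoticVariance
        (fun n => BlockMLE.law (BlockMLE.fullBase (fun _ => volume) (N n))
          (BlockMLE.fullDensity (fun k => BlockMLE.sourceDensity (a k) (C k)) (N n)) l₀)
        (fun n => BlockMLE.averageEst est (N n)) l₀ (fun n => 1 / (K * J n)) ∧
      BlockMLE.IsAsymptoticallyEfficient
        (fun n => BlockMLE.fullBase (fun _ : Fin K => (volume : Measure (Fin p → ℂ))) (N n))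
        (fun n => BlockMLE.fullDensity (fun k => BlockMLE.sourceDensity (a k) (C k)) (N n))
        (fun n => BlockMLE.averageEst est (N n)) l₀) := by
  have hev k : ∀ᶠ l in 𝓝 l₀, l ∈ Λ k := mem_interior_iff_mem_nhds.1 (hl₀ k)
  refine ⟨?_, ?_⟩
  · intro E _ ν _ f hreg p hp0 hp est hest hmle hcons hJ
    have hprob k : IsProbabilityMeasure (BlockMLE.law (ν k) (f k) l₀) :=
      (hreg k).prob l₀ (interior_subset (hl₀ k))
    refine BlockMLE.averageEst_efficient hK hN (fun k => (hreg k).exists_nhds.1)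
      (fun k => (hreg k).info_pos) (fun n => ?_) hest
      (fun k => (hreg k).isAsymptoticallyLinear (hest k) (hmle k) (hcons k)) hJ
    -- the log-likelihoods agree near `l₀`, hence so do the positive likelihoods
    filter_upwards [eventually_all.2 hev] with l hl
    have hl' : l ∈ ⋂ k, Λ k := Set.mem_iInter.2 hl
    ext x
    have hb k : 0 < BlockMLE.blockDensity (f k) (N n k) l (x k) :=
      Finset.prod_pos fun i _ => (hreg k).pos l (hl k) _
    refine Real.log_injOn_pos (hp0 n l hl' x) (Finset.prod_pos fun k _ => hb k) ?_
    exact (hp n l hl' x).trans (Real.log_prod fun k _ => (hb k).ne').symm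
  · intro p a ha C hC hR est hest hmle hJ
    have hexp k := BlockMLE.isExpFamily_sourceDensity (ha k) (hC k) (hR k)
    have hprob k := (hexp k).prob l₀ (interior_subset (hl₀ k))
    refine BlockMLE.averageEst_efficient hK hN (fun k => ((hexp k).isScoreRegular (hl₀ k)).1)
      (fun k => ?_) (fun n => Eventually.of_forall fun l => rfl) hest
      (fun k => (hexp k).isAsymptoticallyLinear (hl₀ k) (hmle k)) hJ
    rw [((hexp k).isScoreRegular (hl₀ k)).2]
    have := (hexp k).s_pos
    have := (hexp k).one_add_pos l₀ (interior_subset (hl₀ k))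
    positivity
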